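/- A graph is a finite CW complex of dimension at most 1. The degree of a vertex $v$ is the number of connected components of $U\setminus\{v\}$ for all sufficiently small connected open neighbourhoods $U$ of $v$, and $m(\Gamma)$ denotes the number of vertices of $\Gamma$ of degree at least 3. For $k\ge 0$ let $F_k(\Gamma)=\{(x_1,\dots,x_k)\in\Gamma^k : x_i\ne x_j \text{ for } i\ne j\}$ be the ordered configuration space and $B_k(\Gamma)=F_k(\Gamma)/\Sigma_k$ the unordered one. For an integer $r\ge 2$, $\mathrm{TC}_r(X)\in\mathbb{N}\cup\{\infty\}$ is the least $n$ such that $X^r$ is covered by at most $n+1$ open sets over each of which the map $X^{[0,1]}\to X^r$, $\gamma\mapsto\bigl(\gamma(0),\gamma(\tfrac{1}{r-1}),\dots,\gamma(1)\bigr)$, has a continuous section; and $\mathrm{TC}_1(X)=\mathrm{cat}(X)$ is the least $n$ such that $X$ is covered by at most $n+1$ open sets whose inclusions into $X$ are null-homotopic (both are $\infty$ if there is no such $n$). Let $\Gamma$ be a connected graph, and let $k\ge 0$ and $r>0$ be integers. If $k\geq 1$, assume that $\Gamma$ is not homeomorphic to a circle. Then \[\mathrm{TC}_r(B_k(\Gamma))\le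 r\,m(\Gamma).\] If moreover $k\le 1$ or $\Gamma$ is not homeomorphic to the closed interval $[0,1]$, then also \[\mathrm{TC}_r(F_k(\Gamma))\le r\,m(\Gamma).\] In particular, both inequalities hold for all $k\ge 0$ and $r>0$ whenever $m(\Gamma)\ge 1$. -/

import Mathlib

open Topology

namespace GraphConfig

/-- A graph is a finite CW complex of dimension at most one. It is given here as a topological
space `Γ` with a CW structure on the whole space; the Hausdorff property is part of being a CW
complex. -/
structure IsGraph (Γ : Type*) [TopologicalSpace Γ] [CWComplex (Set.univ : Set Γ)] : Prop where
  hausdorff : T2Space Γ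
  finite : RelCWComplex.Finite (Set.univ : Set Γ)
  dim_le_one : ∀ n : ℕ, 2 ≤ n → IsEmpty (RelCWComplex.cell (Set.univ : Set Γ) n)

/-- The point `v` has degree `d`: for every sufficiently small connected open neighbourhood `U`
of `v`, the complement of `v` in `U` has exactly `d` connected components. -/
def HasDegree {X : Type*} [TopologicalSpace X] (v : X) (d : ℕ) : Prop :=
  ∃ N ∈ 𝓝 v, ∀ U ⊆ N, IsOpen U → v ∈ U → IsConnected U →
    ENat.card (ConnectedComponents (U \ {v} : Set X)) = d

/-- The point of `Γ` underlying a vertex, that is, a zero-dimensional cell. -/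
def vertexPoint (Γ : Type*) [TopologicalSpace Γ] [CWComplex (Set.univ : Set Γ)]
    (i : RelCWComplex.cell (Set.univ : Set Γ) 0) : Γ :=
  RelCWComplex.map (C := (Set.univ : Set Γ)) 0 i 0

/-- A vertex is essential if its degree is at least three. -/
def IsEssential (Γ : Type*) [TopologicalSpace Γ] [CWComplex (Set.univ : Set Γ)]
    (i : RelCWComplex.cell (Set.univ : Set Γ) 0) : Prop :=
  ∃ d : ℕ, 3 ≤ d ∧ HasDegree (vertexPoint Γ i) d

/-- `m(Γ)`, the number of essential vertices. -/
noncomputable def essentialCount (Γ : Type*) [TopologicalSpace Γ]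
    [CWComplex (Set.univ : Set Γ)] : ℕ :=
  Nat.card {i : RelCWComplex.cell (Set.univ : Set Γ) 0 // IsEssential Γ i}

/-- The ordered configuration space `F_k(X)`, with the subspace topology from `X ^ k`. -/
abbrev OrderedConf (k : ℕ) (X : Type*) : Type _ :=
  {x : Fin k → X // Function.Injective x}

/-- Two ordered configurations are equivalent if they differ by a relabelling of the particles. -/
def relabelSetoid (k : ℕ) (X : Type*) : Setoid (OrderedConf k X) where
  r x y := ∃ σ : Equiv.Perm (Fin k), y.1 = x.1 ∘ σ
  iseqv :=
    { refl := fun _ => ⟨1, rfl⟩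
      symm := by
        rintro x y ⟨σ, h⟩
        refine ⟨σ.symm, ?_⟩
        rw [h]
        funext i
        simp
      trans := by
        rintro x y z ⟨σ, h⟩ ⟨τ, h'⟩
        refine ⟨τ.trans σ, ?_⟩
        rw [h', h]
        rfl }

/-- The unordered configuration space `B_k(X) = F_k(X) / Σ_k`, with the quotient topology. -/
abbrev UnorderedConf (k : ℕ) (X : Type*) : Type _ :=
  Quotient (relabelSetoid k X)

/-- `X` is covered by at most `n + 1` open sets, each with the property `P`. -/
def HasOpenCover {X : Type*} [TopologicalSpace X] (P : Set X → Prop) (n : ℕ) : Prop :=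
  ∃ 𝒰 : Finset (Set X), 𝒰.card ≤ n + 1 ∧ (∀ U ∈ 𝒰, IsOpen U ∧ P U) ∧ ∀ x : X, ∃ U ∈ 𝒰, x ∈ U

/-- The least `n` such that `X` is covered by `n + 1` open sets with the property `P`, and `⊤` if
there is no such `n`. -/
noncomputable def coverNumber {X : Type*} [TopologicalSpace X] (P : Set X → Prop) : ℕ∞ :=
  ⨅ (n : ℕ) (_ : HasOpenCover P n), (n : ℕ∞)

/-- A set is categorical if its inclusion into `X` is null-homotopic. -/
def IsCategorical {X : Type*} [TopologicalSpace X] (U : Set X) : Prop :=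
  ContinuousMap.Nullhomotopic (⟨Subtype.val, continuous_subtype_val⟩ : C(U, X))

/-- The reduced Lusternik–Schnirelmann category. -/
noncomputable def lsCat (X : Type*) [TopologicalSpace X] : ℕ∞ :=
  coverNumber (IsCategorical (X := X))

/-- The time `j / (r - 1)` in the unit interval, for `0 ≤ j ≤ r - 1`. -/
noncomputable def stopTime {r : ℕ} (j : Fin r) : unitInterval :=
  ⟨(j : ℝ) / ((r - 1 : ℕ) : ℝ), by
    have h : (j : ℕ) ≤ r - 1 := by have := j.2; omega
    exact ⟨by positivity, div_le_one_of_le₀ (by exact_mod_cast h) (by positivity)⟩⟩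

/-- `U ⊆ X ^ r` admits a continuous `r`-stop motion planner: a continuous section over `U` of the
map from the path space of `X` (with the compact-open topology) to `X ^ r` that evaluates a path
at the times `0, 1/(r-1), …, 1`. -/
def HasPlanner {X : Type*} [TopologicalSpace X] (r : ℕ) (U : Set (Fin r → X)) : Prop :=
  ∃ s : C(U, C(unitInterval, X)), ∀ (u : U) (j : Fin r), s u (stopTime j) = u.1 j

/-- The reduced sequential topological complexity `TC_r(X)`, for `r ≥ 1`, with the convention
`TC_1 = cat`. -/
noncomputable def TC (r : ℕ) (X : Type*) [TopologicalSpace X] : ℕ∞ :=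
  if r = 1 then lsCat X else coverNumber (HasPlanner (X := X) r)

end GraphConfig

/-! The bound comes from a multiplicity argument. Suppose a path-connected space has `r * m + 1`
open categorical sets such that every point misses at most `m` of them. Then an `r`-tuple of points
misses at most `r * m` of the indices, so the `r`-th powers of the sets cover the `r`-th power of
the space, and each such power has a motion planner through a base point (`TC_le_of_multicover`). It
remains to find such sets in configuration spaces, with `m` at most the number of essential
vertices.

The graph is written as finitely many arcs glued at their ends (`IsGraphModel`). Unless it is a
circle, merging arcs at bivalent points leaves a model in which every glued point, called a branch
point below, has at least three edge ends (`exists_reduced`). Counting components of punctured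
neighbourhoods shows that these branch points are essential vertices of the given CW structure
(`encard_connectedComponents`, `ncard_compl_regularSet_le`).

For a threshold `t` in `(0, 1]`, a configuration is decided if at each branch point either one
particle is closer than all others by the factor `t` (and closer than `t`), or clearly no particle
is. Both alternatives are open. Being undecided at `v` for `t` forces a particle to be near `v` for
every larger threshold, so among increasing thresholds each branch point spoils at most one
(`ncard_notMem_decidedSet_le`). On the decided set, near particles slide into their branch points
while the other particles spread out evenly inside their edges, keeping their order. This is
collision-free, commutes with relabelling, and ends in a locally constant map
(`exists_deformation`), so in a path-connected configuration space the set is categorical, both for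
ordered and for unordered configurations.

Path-connectedness is a separate matter. If there is a branch point, all particles can be driven
into one leg there and sorted using two further legs (`joined_orderedConf`). If there is none, the
graph is an interval, where unordered configurations can still be joined by straight lines, while
ordered ones are only claimed for at most one particle. -/

namespace GraphConfig

open unitInterval

set_option linter.unusedSectionVars false

universe u

/-! ### Categorical sets, motion planners and the multiplicity bound. -/

section Homotopy

variable {X : Type*} [TopologicalSpace X]

/-- After the homotopy `H`, each endpoint is carried to a base point along a path chosen for its
value. The choice is arbitrary, but it is continuous because the endpoint map is locally constant.
-/
theorem isCategorical_of_homotopy [PathConnectedSpace X] {U : Set X} (H : I × U → X)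
    (hH : Continuous H) (h0 : ∀ u, H (0, u) = u)
    (h1 : ∀ u : U, ∀ᶠ w in 𝓝 u, H (1, w) = H (1, u)) : IsCategorical U := by
  obtain ⟨x₀⟩ := (inferInstance : Nonempty X)
  let γ : ∀ x : X, Path x x₀ := fun x => (PathConnectedSpace.joined x x₀).somePath
  have hG : Continuous fun p : I × U => γ (H (1, p.2)) p.1 := by
    rw [continuous_iff_continuousAt]
    rintro ⟨s, u⟩
    have hloc : (fun p : I × U => γ (H (1, u)) p.1) =ᶠ[𝓝 (s, u)]
        fun p : I × U => γ (H (1, p.2)) p.1 := by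
      have := (continuous_snd (X := I) (Y := U)).continuousAt (x := (s, u)) |>.eventually (h1 u)
      filter_upwards [this] with p hp
      have hp' : H (1, p.2) = H (1, u) := hp
      rw [hp']
    exact ContinuousAt.congr (by fun_prop) hloc
  have e1 : ContinuousMap.Homotopic (⟨Subtype.val, continuous_subtype_val⟩ : C(U, X))
      ⟨fun u => H (1, u), by fun_prop⟩ :=
    ⟨{ toFun := H, continuous_toFun := hH, map_zero_left := h0, map_one_left := fun _ => rfl }⟩
  have e2 : ContinuousMap.Homotopic (⟨fun u => H (1, u), by fun_prop⟩ : C(U, X))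
      (ContinuousMap.const U x₀) :=
    ⟨{ toFun := fun p => γ (H (1, p.2)) p.1
       continuous_toFun := hG
       map_zero_left := fun u => (γ (H (1, u))).source
       map_one_left := fun u => (γ (H (1, u))).target }⟩
  exact ⟨x₀, e1.trans e2⟩

/-- The planner runs from each stop to the base point along the contraction of `U`, then backwards
along the contraction to the next stop. -/
theorem hasPlanner_of_isCategorical {r : ℕ} (hr : 2 ≤ r) {U : Set X} (hU : IsCategorical U) :
    HasPlanner r {y : Fin r → X | ∀ j, y j ∈ U} := by
  obtain ⟨x₀, ⟨F⟩⟩ := hU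
  set V : Set (Fin r → X) := {y | ∀ j, y j ∈ U}
  -- In rescaled time stop `j` occurs at the integer `j`; `δ j` is the distance to it. The base
  -- point is reached at distance `1 / 2`, midway between stops, hence the factor `2` in `f`.
  let δ : Fin r → V × I → ℝ := fun j p => |(p.2 : ℝ) * ((r - 1 : ℕ) : ℝ) - j|
  have hδ : ∀ j, Continuous (δ j) := fun j => by unfold δ; fun_prop
  let f : Fin r → V × I → X := fun j p =>
    F (Set.projIcc 0 1 zero_le_one (2 * δ j p), ⟨p.1.1 j, p.1.2 j⟩)
  have hf : ∀ j, Continuous (f j) := by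
    intro j
    refine F.continuous.comp (Continuous.prodMk ?_ ?_)
    · exact continuous_projIcc.comp (by have := hδ j; fun_prop)
    · exact Continuous.subtype_mk ((continuous_apply j).comp (continuous_subtype_val.comp continuous_fst)) _
  let C : Fin r → Set (V × I) := fun j => {p | δ j p ≤ 1 / 2}
  have hC : ∀ j, IsClosed (C j) := fun j => isClosed_le (hδ j) continuous_const
  have hcov : ∀ p, ∃ j, p ∈ C j := by
    rintro ⟨y, τ⟩
    have h0 : 0 ≤ (τ : ℝ) * ((r - 1 : ℕ) : ℝ) := mul_nonneg τ.2.1 (by positivity)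
    have h1 : (τ : ℝ) * ((r - 1 : ℕ) : ℝ) ≤ ((r - 1 : ℕ) : ℝ) :=
      mul_le_of_le_one_left (by positivity) τ.2.2
    set a := (τ : ℝ) * ((r - 1 : ℕ) : ℝ) with ha
    have hfl := Nat.floor_le (a := a + 1 / 2) (by linarith)
    have hlt := Nat.lt_floor_add_one (a + 1 / 2)
    have hle : ⌊a + 1 / 2⌋₊ < r := by
      have : (⌊a + 1 / 2⌋₊ : ℝ) < ((r - 1 : ℕ) : ℝ) + 1 := by linarith
      have : ⌊a + 1 / 2⌋₊ < (r - 1) + 1 := by exact_mod_cast this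
      omega
    refine ⟨⟨_, hle⟩, ?_⟩
    change |a - (⌊a + 1 / 2⌋₊ : ℝ)| ≤ 1 / 2
    rw [abs_le]; constructor <;> linarith
  -- Two different pieces overlap only at half-integers, where both formulas give the base point.
  have hov : ∀ p i j, p ∈ C i → p ∈ C j → f i p = f j p := by
    intro p i j hi hj
    by_cases hij : i = j
    · rw [hij]
    have hi' := abs_le.1 (show |(p.2 : ℝ) * ((r - 1 : ℕ) : ℝ) - i| ≤ 1 / 2 from hi)
    have hj' := abs_le.1 (show |(p.2 : ℝ) * ((r - 1 : ℕ) : ℝ) - j| ≤ 1 / 2 from hj)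
    have hij' : (1 : ℝ) ≤ |((i : ℕ) : ℝ) - ((j : ℕ) : ℝ)| := by
      have h : ((i : ℕ) : ℤ) - ((j : ℕ) : ℤ) ≠ 0 := by
        intro h; apply hij; ext; omega
      exact_mod_cast Int.one_le_abs h
    have key : ∀ l, l ∈ ({i, j} : Set (Fin r)) → δ l p = 1 / 2 := by
      rintro l (rfl | rfl)
      · change |_| = _
        rcases le_abs.1 hij' with h | h
        · rw [abs_of_nonpos] <;> linarith
        · rw [abs_of_nonneg] <;> linarith
      · change |_| = _
        rcases le_abs.1 hij' with h | h
        · rw [abs_of_nonneg] <;> linarith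
        · rw [abs_of_nonpos] <;> linarith
    have hone : ∀ l, δ l p = 1 / 2 → f l p = x₀ := by
      intro l hl
      have : Set.projIcc (0 : ℝ) 1 zero_le_one (2 * δ l p) = 1 := by
        rw [hl]; norm_num
      simp only [f, this]
      simp
    rw [hone i (key i (by simp)), hone j (key j (by simp))]
  choose J hJ using hcov
  let P : V × I → X := fun p => f (J p) p
  have hP : Continuous P := by
    refine (locallyFinite_of_finite C).continuous ?_ hC ?_
    · exact Set.eq_univ_of_forall fun p => Set.mem_iUnion.2 ⟨J p, hJ p⟩
    · intro j
      exact (hf j).continuousOn.congr fun p hp => hov p _ _ (hJ p) hp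
  refine ⟨ContinuousMap.curry ⟨P, hP⟩, ?_⟩
  intro u j
  have hr1 : ((r - 1 : ℕ) : ℝ) ≠ 0 := by
    have : r - 1 ≠ 0 := by omega
    exact_mod_cast this
  have hz : δ j (u, stopTime j) = 0 := by
    change |(j : ℝ) / ((r - 1 : ℕ) : ℝ) * ((r - 1 : ℕ) : ℝ) - j| = 0
    rw [div_mul_cancel₀ _ hr1]; simp
  have hmem : (u, stopTime j) ∈ C j := by
    change δ j _ ≤ _
    rw [hz]; norm_num
  change f (J (u, stopTime j)) (u, stopTime j) = _
  rw [hov _ _ _ (hJ _) hmem]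
  have : Set.projIcc (0 : ℝ) 1 zero_le_one (2 * δ j (u, stopTime j)) = 0 := by
    rw [hz]; norm_num
  simp only [f, this]
  simp

theorem coverNumber_le {P : Set X → Prop} {n : ℕ} (U : Fin (n + 1) → Set X)
    (hU : ∀ i, IsOpen (U i)) (hP : ∀ i, P (U i)) (hcov : ∀ x, ∃ i, x ∈ U i) :
    coverNumber P ≤ n := by
  classical
  refine iInf₂_le n ⟨Finset.univ.image U, ?_, ?_, ?_⟩
  · exact Finset.card_image_le.trans (by simp)
  · intro V hV
    obtain ⟨i, -, rfl⟩ := Finset.mem_image.1 hV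
    exact ⟨hU i, hP i⟩
  · intro x
    obtain ⟨i, hi⟩ := hcov x
    exact ⟨U i, Finset.mem_image_of_mem _ (Finset.mem_univ i), hi⟩

/-- If every point lies in all but at most `m` of `r * m + 1` categorical open sets, then the
`r`-th powers of these sets cover the `r`-th power of the space. -/
theorem TC_le_of_multicover {r m : ℕ} (hr : 0 < r) (U : Fin (r * m + 1) → Set X)
    (hU : ∀ i, IsOpen (U i)) (hcat : ∀ i, IsCategorical (U i))
    (hmiss : ∀ x, {i | x ∉ U i}.ncard ≤ m) : TC r X ≤ ((r * m : ℕ) : ℕ∞) := by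
  classical
  -- Each of the `r` coordinates excludes at most `m` of the `r * m + 1` indices, so some index
  -- survives.
  have hall : ∀ y : Fin r → X, ∃ i, ∀ j, y j ∈ U i := by
    intro y
    by_contra! hcon
    have hsub : (Set.univ : Set (Fin (r * m + 1))) ⊆
        ⋃ j ∈ (Finset.univ : Finset (Fin r)), {i | y j ∉ U i} := by
      intro i _
      obtain ⟨j, hj⟩ := hcon i
      simp only [Set.mem_iUnion]
      exact ⟨j, Finset.mem_univ j, hj⟩
    have h1 := Set.ncard_le_ncard hsub (Set.toFinite _)
    have h2 : (⋃ j ∈ (Finset.univ : Finset (Fin r)), {i | y j ∉ U i}).ncard ≤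
        ∑ j : Fin r, {i | y j ∉ U i}.ncard := Finset.set_ncard_biUnion_le _ _
    have h3 : ∑ j : Fin r, {i | y j ∉ U i}.ncard ≤ ∑ _j : Fin r, m :=
      Finset.sum_le_sum fun j _ => hmiss (y j)
    rw [Set.ncard_univ, Nat.card_eq_fintype_card, Fintype.card_fin] at h1
    simp at h3
    omega
  unfold TC
  split_ifs with h
  · subst h
    refine coverNumber_le U hU hcat fun x => ?_
    obtain ⟨i, hi⟩ := hall fun _ => x
    exact ⟨i, hi 0⟩
  · refine coverNumber_le (fun i => {y | ∀ j, y j ∈ U i}) (fun i => ?_)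
      (fun i => hasPlanner_of_isCategorical (by omega) (hcat i)) hall
    have : {y : Fin r → X | ∀ j, y j ∈ U i} = ⋂ j, (fun y : Fin r → X => y j) ⁻¹' U i := by
      ext y; simp
    change IsOpen {y : Fin r → X | ∀ j, y j ∈ U i}
    rw [this]
    exact isOpen_iInter_of_finite fun j => (hU i).preimage (continuous_apply j)

theorem TC_eq_zero_of_subsingleton [Subsingleton X] (r : ℕ) (hr : 0 < r) : TC r X = 0 := by
  rcases isEmpty_or_nonempty X with hX | ⟨⟨x₀⟩⟩
  -- An empty space has no point for a null-homotopy to end at, so the empty cover is used; for the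
  -- power `Fin r → X` this needs `0 < r`.
  · unfold TC
    split_ifs with h
    · refine le_antisymm (iInf₂_le 0 ⟨∅, by simp, by simp, fun x => (hX.false x).elim⟩) bot_le
    · refine le_antisymm (iInf₂_le 0 ⟨∅, by simp, by simp, fun x => ?_⟩) bot_le
      exact (hX.false (x ⟨0, hr⟩)).elim
  · have hcat : ∀ U : Set X, IsCategorical U := fun U => by
      refine ⟨x₀, ?_⟩
      have : (⟨Subtype.val, continuous_subtype_val⟩ : C(U, X)) = ContinuousMap.const U x₀ := by
        ext u; exact Subsingleton.elim _ _
      rw [this]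
    have := TC_le_of_multicover (m := 0) hr (fun _ => (Set.univ : Set X)) (fun _ => isOpen_univ)
      (fun _ => hcat _) (fun x => by simp)
    simpa using this

end Homotopy

/-! ### Relabelling and the quotient from ordered to unordered configurations. -/

section Conf

variable {k : ℕ} {X : Type*}

/-- Relabelling of the particles of a configuration. -/
def OrderedConf.relabel (x : OrderedConf k X) (π : Equiv.Perm (Fin k)) : OrderedConf k X :=
  ⟨x.1 ∘ π, x.2.comp π.injective⟩

@[simp]
theorem OrderedConf.relabel_val (x : OrderedConf k X) (π : Equiv.Perm (Fin k)) (i : Fin k) :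
    (x.relabel π).1 i = x.1 (π i) := rfl

/-- The projection from ordered to unordered configurations. -/
def toUnordered (x : OrderedConf k X) : UnorderedConf k X := Quotient.mk _ x

theorem toUnordered_eq {x y : OrderedConf k X} :
    toUnordered x = toUnordered y ↔ ∃ π, y = x.relabel π := by
  refine Quotient.eq.trans ⟨fun ⟨π, h⟩ => ⟨π, Subtype.ext h⟩, fun ⟨π, h⟩ => ⟨π, ?_⟩⟩
  rw [h]; rfl

theorem toUnordered_surjective : Function.Surjective (toUnordered (k := k) (X := X)) :=
  Quotient.mk_surjective

variable [TopologicalSpace X]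

theorem OrderedConf.continuous_relabel (π : Equiv.Perm (Fin k)) :
    Continuous fun x : OrderedConf k X => x.relabel π :=
  by
  have : Continuous fun x : OrderedConf k X => x.1 ∘ π :=
    continuous_pi fun i => (continuous_apply (π i)).comp continuous_subtype_val
  exact this.subtype_mk _

theorem continuous_toUnordered : Continuous (toUnordered (k := k) (X := X)) :=
  continuous_quotient_mk'

/-- The saturation of an open set is the union of its preimages under the finitely many
relabellings. -/
theorem isOpenQuotientMap_toUnordered : IsOpenQuotientMap (toUnordered (k := k) (X := X)) := by
  refine ⟨toUnordered_surjective, continuous_toUnordered, fun U hU => ?_⟩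
  refine (isQuotientMap_quotient_mk' (s := relabelSetoid k X)).isOpen_preimage.1 ?_
  have : (Quotient.mk (relabelSetoid k X)) ⁻¹' (toUnordered '' U) =
      ⋃ π : Equiv.Perm (Fin k), (fun x : OrderedConf k X => x.relabel π) ⁻¹' U := by
    ext x
    simp only [Set.mem_preimage, Set.mem_image, Set.mem_iUnion]
    constructor
    · rintro ⟨y, hy, hyx⟩
      obtain ⟨π, rfl⟩ := toUnordered_eq.1 (show toUnordered x = toUnordered y from hyx.symm)
      exact ⟨π, hy⟩
    · rintro ⟨π, h⟩
      exact ⟨_, h, (toUnordered_eq.2 ⟨π, rfl⟩).symm⟩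
  have h2 : IsOpen ((Quotient.mk (relabelSetoid k X)) ⁻¹' (toUnordered '' U)) := by
    rw [this]
    exact isOpen_iUnion fun π => hU.preimage (OrderedConf.continuous_relabel π)
  exact h2

/-- An equivariant deformation of an invariant open set of ordered configurations to a locally
constant map makes the corresponding set of unordered configurations categorical. -/
theorem isCategorical_image_toUnordered [PathConnectedSpace (UnorderedConf k X)]
    {U : Set (OrderedConf k X)}
    (hUinv : ∀ x ∈ U, ∀ π, x.relabel π ∈ U) (H : I × U → OrderedConf k X)
    (hH : Continuous H) (h0 : ∀ u, H (0, u) = u)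
    (h1 : ∀ u : U, ∀ᶠ w in 𝓝 u, H (1, w) = H (1, u))
    (heq : ∀ s (u : U) π, H (s, ⟨u.1.relabel π, hUinv _ u.2 π⟩) = (H (s, u)).relabel π) :
    IsCategorical (toUnordered '' U) := by
  set V := toUnordered '' U
  let q : U → V := fun u => ⟨toUnordered u.1, u.1, u.2, rfl⟩
  have hq : IsOpenQuotientMap q := by
    have hpre : toUnordered ⁻¹' V = U := by
      ext x
      constructor
      · rintro ⟨y, hy, hyx⟩
        obtain ⟨π, rfl⟩ := toUnordered_eq.1 hyx
        exact hUinv y hy π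
      · exact fun hx => ⟨x, hx, rfl⟩
    refine ⟨?_, Continuous.subtype_mk (continuous_toUnordered.comp continuous_subtype_val) _, ?_⟩
    · rintro ⟨_, x, hx, rfl⟩
      exact ⟨⟨x, hx⟩, rfl⟩
    · have h := isOpenQuotientMap_toUnordered (k := k) (X := X) |>.isOpenMap.restrictPreimage V
      intro W hW
      obtain ⟨W', hW', rfl⟩ := isOpen_induced_iff.1 hW
      have := h _ (isOpen_induced_iff.2 ⟨W', hW', rfl⟩)
      convert this using 1
      ext v
      simp only [Set.mem_image, Set.mem_preimage]
      constructor
      · rintro ⟨u, hu, rfl⟩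
        exact ⟨⟨u.1, by rw [hpre]; exact u.2⟩, hu, rfl⟩
      · rintro ⟨u, hu, rfl⟩
        exact ⟨⟨u.1, by rw [← hpre]; exact u.2⟩, hu, rfl⟩
  -- Openness of `q` is what keeps the product with the interval a quotient map, so that the
  -- equivariant homotopy descends continuously.
  have hqq : IsOpenQuotientMap (Prod.map (id : I → I) q) := IsOpenQuotientMap.id.prodMap hq
  have hresp : ∀ s (u w : U), q u = q w → toUnordered (H (s, u)) = toUnordered (H (s, w)) := by
    intro s u w huw
    obtain ⟨π, hπ⟩ := toUnordered_eq.1 (congrArg Subtype.val huw)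
    have : w = ⟨u.1.relabel π, hUinv _ u.2 π⟩ := Subtype.ext hπ
    rw [this, heq]
    exact toUnordered_eq.2 ⟨π, rfl⟩
  have hinv := Function.surjInv_eq hq.surjective
  let G : I × V → UnorderedConf k X := fun p =>
    toUnordered (H (p.1, Function.surjInv hq.surjective p.2))
  have hGq : ∀ s u, G (s, q u) = toUnordered (H (s, u)) := fun s u => hresp _ _ _ (hinv _)
  refine isCategorical_of_homotopy G ?_ ?_ ?_
  · rw [hqq.isQuotientMap.continuous_iff]
    have : G ∘ Prod.map id q = toUnordered ∘ H := by
      funext ⟨s, u⟩; exact hGq s u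
    rw [this]
    exact continuous_toUnordered.comp hH
  · intro v
    obtain ⟨u, rfl⟩ := hq.surjective v
    rw [hGq, h0]
  · intro v
    obtain ⟨u, rfl⟩ := hq.surjective v
    have := (h1 u)
    have h2 := hq.isOpenMap.image_mem_nhds this
    filter_upwards [h2]
    rintro _ ⟨w, hw, rfl⟩
    rw [hGq, hGq, show H (1, w) = H (1, u) from hw]

end Conf

/-! ### Graphs as glued arcs; distance to a point and contraction of its star. -/

/-- A presentation of a space as a finite union of arcs glued along their endpoints. -/
structure IsGraphModel {E Γ : Type*} [TopologicalSpace E] [TopologicalSpace Γ] (Φ : E × I → Γ) :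
    Prop where
  continuous : Continuous Φ
  surjective : Function.Surjective Φ
  eq_of_interior : ∀ (e : E) (c : I) (a : E × I), 0 < c → c < 1 → Φ a = Φ (e, c) → a = (e, c)

/-- The parametrization of an edge, extended to all real parameters. -/
noncomputable def edge {E Γ : Type*} (Φ : E × I → Γ) (e : E) (x : ℝ) : Γ :=
  Φ (e, Set.projIcc 0 1 zero_le_one x)

/-- The points over which a parametrization is injective. -/
def regularSet {E Γ : Type*} (Φ : E × I → Γ) : Set Γ := {p | ∀ a b, Φ a = p → Φ b = p → a = b}

open Classical in
/-- The distance to `v` of the point with given coordinates, with all edges having length `4`,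
truncated at `1`. -/
noncomputable def starDistAux {E Γ : Type*} (Φ : E × I → Γ) (v : Γ) (a : E × I) : ℝ :=
  min 1 (4 * min (if Φ (a.1, 0) = v then (a.2 : ℝ) else 1)
    (if Φ (a.1, 1) = v then 1 - (a.2 : ℝ) else 1))

open Classical in
/-- The coordinate at time `s` of the contraction towards `v` of the coordinate `a.2`. -/
noncomputable def contractCoord {E Γ : Type*} (Φ : E × I → Γ) (v : Γ) (a : E × I) (s : I) : ℝ :=
  a.2 - s * ((if Φ (a.1, 0) = v then 1 else 0) * max 0 (min (a.2 : ℝ) (1 / 2 - a.2))) +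
    s * ((if Φ (a.1, 1) = v then 1 else 0) * max 0 (min (1 - a.2 : ℝ) (a.2 - 1 / 2)))

namespace IsGraphModel

theorem edge_coe {E Γ : Type*} (Φ : E × I → Γ) (e : E) (c : I) : edge Φ e c = Φ (e, c) := by
  simp [edge]

theorem edge_of_mem {E Γ : Type*} (Φ : E × I → Γ) (e : E) {x : ℝ} (hx : x ∈ Set.Icc (0 : ℝ) 1) :
    edge Φ e x = Φ (e, ⟨x, hx⟩) := by
  simp [edge, Set.projIcc_of_mem _ hx]

variable {E Γ : Type*} [TopologicalSpace E] [DiscreteTopology E] [Finite E]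
  [TopologicalSpace Γ] {Φ : E × I → Γ} (h : IsGraphModel Φ)

include h

theorem nonempty_of_point (p : Γ) : Nonempty (E × I) := ⟨(h.surjective p).choose⟩

theorem endpoint_of_ne {a b : E × I} (hab : Φ a = Φ b) (hne : a ≠ b) : a.2 = 0 ∨ a.2 = 1 := by
  by_contra! hcon
  have := h.eq_of_interior a.1 a.2 b (unitInterval.pos_iff_ne_zero.2 hcon.1)
    (unitInterval.lt_one_iff_ne_one.2 hcon.2) hab.symm
  exact hne this.symm

theorem continuous_edge : Continuous fun p : E × ℝ => edge Φ p.1 p.2 :=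
  h.continuous.comp (continuous_fst.prodMk (continuous_projIcc.comp continuous_snd))

theorem exists_endpoint_of_not_regular {v : Γ} (hv : v ∉ regularSet Φ) :
    ∃ a : E × I, Φ a = v ∧ (a.2 = 0 ∨ a.2 = 1) := by
  simp only [regularSet, Set.mem_ofPred_eq, not_forall] at hv
  obtain ⟨a, b, ha, hb, hne⟩ := hv
  exact ⟨a, ha, h.endpoint_of_ne (ha.trans hb.symm) hne⟩

theorem finite_compl_regularSet : (regularSet Φ)ᶜ.Finite := by
  refine ((Set.finite_univ (α := E)).prod (Set.toFinite {(0 : I), 1}) |>.image Φ).subset ?_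
  intro v hv
  obtain ⟨a, ha, hend⟩ := h.exists_endpoint_of_not_regular hv
  exact ⟨a, ⟨Set.mem_univ _, hend⟩, ha⟩

theorem isQuotientMap [T2Space Γ] : IsQuotientMap Φ :=
  IsQuotientMap.of_surjective_continuous h.surjective h.continuous

theorem isClosedMap [T2Space Γ] : IsClosedMap Φ := h.continuous.isClosedMap

theorem compactSpace : CompactSpace Γ := by
  have := isCompact_range h.continuous
  rw [h.surjective.range_eq] at this
  exact ⟨this⟩

omit [DiscreteTopology E] [Finite E] in
theorem comp_surjInv_apply {Y : Type*} {f : E × I → Y}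
    (hf : ∀ a b, Φ a = Φ b → f a = f b) (a : E × I) :
    f (Function.surjInv h.surjective (Φ a)) = f a :=
  hf _ _ (Function.surjInv_eq h.surjective _)

/-- `Φ` maps a compact space onto a Hausdorff one, hence is a quotient map, and functions constant
on its fibres descend. -/
theorem continuous_comp_surjInv [T2Space Γ] {Y : Type*} [TopologicalSpace Y] {f : E × I → Y}
    (hf : ∀ a b, Φ a = Φ b → f a = f b) (hfc : Continuous f) :
    Continuous fun p => f (Function.surjInv h.surjective p) := by
  rw [h.isQuotientMap.continuous_iff]
  exact hfc.congr fun a => (h.comp_surjInv_apply hf a).symm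

/-- The coordinates of a point. -/
noncomputable def coord (p : Γ) : E × I := Function.surjInv h.surjective p

theorem apply_coord (p : Γ) : Φ (h.coord p) = p := Function.surjInv_eq h.surjective p

theorem coord_eq {p : Γ} (hp : p ∈ regularSet Φ) {a : E × I} (ha : Φ a = p) : h.coord p = a :=
  hp _ _ (h.apply_coord p) ha

/-- `Φ` is closed, so the coordinates outside a neighbourhood of the unique preimage of `p` have a
closed image missing `p`. -/
theorem continuousAt_coord [T2Space Γ] {p : Γ} (hp : p ∈ regularSet Φ) :
    ContinuousAt h.coord p := by
  intro O hO
  obtain ⟨O', hO', hopen, hmem⟩ := mem_nhds_iff.1 hO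
  have hclosed : IsClosed (Φ '' O'ᶜ) := h.isClosedMap _ hopen.isClosed_compl
  have hp' : p ∉ Φ '' O'ᶜ := by
    rintro ⟨a, ha, hap⟩
    exact ha (by rw [← h.coord_eq hp hap]; exact hmem)
  change ∀ᶠ q in 𝓝 p, h.coord q ∈ O
  filter_upwards [hclosed.isOpen_compl.mem_nhds hp'] with q hq
  refine hO' ?_
  by_contra hcon
  exact hq ⟨_, hcon, h.apply_coord q⟩

omit [DiscreteTopology E] [Finite E] h [TopologicalSpace E] [TopologicalSpace Γ] in
theorem starDistAux_endpoint (v : Γ) {a : E × I} (ha : a.2 = 0 ∨ a.2 = 1) [Decidable (Φ a = v)] :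
    starDistAux Φ v a = if Φ a = v then 0 else 1 := by
  obtain ⟨e, c⟩ := a
  rcases ha with rfl | rfl <;> simp only [starDistAux] <;> split_ifs <;> norm_num

/-- Only edge ends are glued, and at an end the value depends just on whether the point is `v`. -/
theorem starDistAux_congr (v : Γ) (a b : E × I) (hab : Φ a = Φ b) :
    starDistAux Φ v a = starDistAux Φ v b := by
  classical
  by_cases hne : a = b
  · rw [hne]
  · rw [starDistAux_endpoint v (h.endpoint_of_ne hab hne),
      starDistAux_endpoint v (h.endpoint_of_ne hab.symm (Ne.symm hne)), hab]

/-- The distance to `v`, with all edges having length `4`, truncated at `1`. -/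
noncomputable def starDist (v p : Γ) : ℝ := starDistAux Φ v (h.coord p)

theorem starDist_apply (v : Γ) (a : E × I) : h.starDist v (Φ a) = starDistAux Φ v a :=
  h.comp_surjInv_apply (h.starDistAux_congr v) a

theorem continuous_starDist [T2Space Γ] (v : Γ) : Continuous (h.starDist v) := by
  classical
  refine h.continuous_comp_surjInv (h.starDistAux_congr v) ?_
  rw [continuous_prod_of_discrete_left]
  intro e
  unfold starDistAux
  refine continuous_const.min (continuous_const.mul (Continuous.min ?_ ?_)) <;> dsimp only <;>
    split_ifs <;> fun_prop

-- The cut-off terms vanish at both ends of an edge. Since ends stay fixed, the contraction is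
-- compatible with the gluing and descends to `Γ`.
omit [DiscreteTopology E] [Finite E] h [TopologicalSpace E] [TopologicalSpace Γ] in
theorem contractCoord_endpoint (v : Γ) {a : E × I} (ha : a.2 = 0 ∨ a.2 = 1) (s : I) :
    contractCoord Φ v a s = a.2 := by
  obtain ⟨e, c⟩ := a
  rcases ha with rfl | rfl <;> simp only [contractCoord] <;> split_ifs <;> norm_num

omit [DiscreteTopology E] [Finite E] [TopologicalSpace E] [TopologicalSpace Γ] h in
/-- A point near `v` lies on an edge that ends at `v`. -/
theorem exists_end_of_starDistAux_lt {v : Γ} {a : E × I} (hlt : starDistAux Φ v a < 1) :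
    ∃ τ : I, (τ = 0 ∨ τ = 1) ∧ Φ (a.1, τ) = v ∧ starDistAux Φ v a = 4 * |(a.2 : ℝ) - τ| ∧
      ∀ s : I, contractCoord Φ v a s = (1 - s) * a.2 + s * τ := by
  classical
  obtain ⟨e, c⟩ := a
  have hc0 := c.2.1
  have hc1 := c.2.2
  have hlt' := hlt
  simp only [starDistAux, min_lt_iff, lt_irrefl, false_or] at hlt
  -- The coordinate lies within `1 / 4` of an end at `v`. There the cut-off for the other end is
  -- zero, and the contraction is plain linear interpolation, even if the edge is a loop.
  have hlt2 : min (if Φ (e, 0) = v then (c : ℝ) else 1) (if Φ (e, 1) = v then 1 - (c : ℝ) else 1)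
      < 1 / 4 := by linarith
  rw [min_lt_iff] at hlt2
  rcases hlt2 with h0 | h0
  · split_ifs at h0 with hv
    · refine ⟨0, Or.inl rfl, hv, ?_, fun s => ?_⟩
      · have : min (if Φ (e, 0) = v then (c : ℝ) else 1)
            (if Φ (e, 1) = v then 1 - (c : ℝ) else 1) = c := by
          rw [if_pos hv, min_eq_left]; split_ifs <;> linarith
        simp only [starDistAux, this]
        rw [min_eq_right (by linarith)]
        simp [abs_of_nonneg hc0]
      · simp only [contractCoord]
        rw [if_pos hv, max_eq_right (le_min hc0 (by linarith)), min_eq_left (by linarith),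
          max_eq_left (min_le_of_right_le (by linarith))]
        simp; ring
    · norm_num at h0
  · split_ifs at h0 with hv
    · refine ⟨1, Or.inr rfl, hv, ?_, fun s => ?_⟩
      · have : min (if Φ (e, 0) = v then (c : ℝ) else 1)
            (if Φ (e, 1) = v then 1 - (c : ℝ) else 1) = 1 - c := by
          rw [if_pos hv, min_eq_right]; split_ifs <;> linarith
        simp only [starDistAux, this]
        rw [min_eq_right (by linarith), abs_of_nonpos (by simpa using hc1)]
        simp
      · simp only [contractCoord]
        rw [if_pos hv, max_eq_left (min_le_of_right_le (by linarith)),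
          min_eq_left (by linarith), max_eq_right (by linarith)]
        simp; ring
    · norm_num at h0

/-- The contraction of the star of `v`, as a continuous family of paths. -/
noncomputable def contractAux (v : Γ) : C(E × I, C(I, Γ)) :=
  ContinuousMap.curry ⟨fun p => edge Φ p.1.1 (contractCoord Φ v p.1 p.2), by
    refine h.continuous_edge.comp ((continuous_fst.comp continuous_fst).prodMk ?_)
    classical
    have z0 : Continuous fun e : E => (if Φ (e, (0 : I)) = v then (1 : ℝ) else 0) :=
      continuous_of_discreteTopology
    have z1 : Continuous fun e : E => (if Φ (e, (1 : I)) = v then (1 : ℝ) else 0) :=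
      continuous_of_discreteTopology
    have z0' := z0.comp (continuous_fst.comp (continuous_fst (X := E × I) (Y := I)))
    have z1' := z1.comp (continuous_fst.comp (continuous_fst (X := E × I) (Y := I)))
    simp only [Function.comp_def] at z0' z1'
    have key : ∀ w₀ w₁ : (E × I) × I → ℝ, Continuous w₀ → Continuous w₁ →
        Continuous fun p : (E × I) × I =>
          (p.1.2 : ℝ) - p.2 * (w₀ p * max 0 (min (p.1.2 : ℝ) (1 / 2 - p.1.2))) +
            p.2 * (w₁ p * max 0 (min (1 - p.1.2 : ℝ) (p.1.2 - 1 / 2))) := by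
      intro w₀ w₁ h₀ h₁
      fun_prop
    exact key _ _ z0' z1'⟩

theorem contractAux_apply (v : Γ) (a : E × I) (s : I) :
    h.contractAux v a s = edge Φ a.1 (contractCoord Φ v a s) := rfl

theorem contractAux_congr (v : Γ) (a b : E × I) (hab : Φ a = Φ b) :
    h.contractAux v a = h.contractAux v b := by
  by_cases hne : a = b
  · rw [hne]
  · ext s
    rw [contractAux_apply, contractAux_apply,
      contractCoord_endpoint v (h.endpoint_of_ne hab hne),
      contractCoord_endpoint v (h.endpoint_of_ne hab.symm (Ne.symm hne)), edge_coe, edge_coe]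
    exact hab

/-- The contraction of the star of `v`. -/
noncomputable def contract (v p : Γ) : C(I, Γ) := h.contractAux v (h.coord p)

theorem continuous_contract [T2Space Γ] (v : Γ) : Continuous (h.contract v) :=
  h.continuous_comp_surjInv (h.contractAux_congr v) (h.contractAux v).continuous

theorem exists_coord_of_starDist_lt {v p : Γ} (hp : h.starDist v p < 1) :
    ∃ (e : E) (c τ : I), Φ (e, c) = p ∧ (τ = 0 ∨ τ = 1) ∧ Φ (e, τ) = v ∧
      h.starDist v p = 4 * |(c : ℝ) - τ| ∧
      ∀ s : I, h.contract v p s = edge Φ e ((1 - s) * c + s * τ) := by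
  obtain ⟨τ, h1, h2, h3, h4⟩ := exists_end_of_starDistAux_lt hp
  refine ⟨(h.coord p).1, (h.coord p).2, τ, h.apply_coord p, h1, h2, h3, fun s => ?_⟩
  rw [← h4]; rfl

theorem starDist_nonneg (v p : Γ) : 0 ≤ h.starDist v p := by
  by_cases hp : h.starDist v p < 1
  · obtain ⟨e, c, τ, -, -, -, h4, -⟩ := h.exists_coord_of_starDist_lt hp
    rw [h4]; positivity
  · linarith

theorem starDist_le {v : Γ} {e : E} {τ : I} (hτ : τ = 0 ∨ τ = 1) (hv : Φ (e, τ) = v) (c : I) :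
    h.starDist v (Φ (e, c)) ≤ 4 * |(c : ℝ) - τ| := by
  classical
  rw [h.starDist_apply]
  refine (min_le_right _ _).trans (mul_le_mul_of_nonneg_left ?_ (by norm_num))
  rcases hτ with rfl | rfl
  · refine (min_le_left _ _).trans ?_
    rw [if_pos hv]
    simpa using le_abs_self _
  · refine (min_le_right _ _).trans ?_
    rw [if_pos hv]
    simpa [abs_sub_comm] using le_abs_self (1 - (c : ℝ))

theorem eq_of_starDist_eq_zero {v p : Γ} (hp : h.starDist v p = 0) : p = v := by
  obtain ⟨e, c, τ, h1, h2, h3, h4, -⟩ := h.exists_coord_of_starDist_lt (hp.trans_lt one_pos)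
  rw [h4] at hp
  have : c = τ := by
    ext; have := abs_eq_zero.1 (by linarith : |(c : ℝ) - τ| = 0); linarith
  rw [← h1, ← h3, this]

theorem starDist_self {v : Γ} (hv : v ∉ regularSet Φ) : h.starDist v v = 0 := by
  obtain ⟨⟨e, τ⟩, ha, hend⟩ := h.exists_endpoint_of_not_regular hv
  refine le_antisymm ?_ (h.starDist_nonneg v v)
  have := h.starDist_le hend ha τ
  rw [ha] at this
  simpa using this

/-- Open stars of radius one are disjoint. If `p` is seen through the same coordinates, these lie
within `1 / 4` of only one end; if through different ones, `p` is a glued end and so equals both `v`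
and `w`. -/
theorem eq_of_starDist_lt {v w p : Γ} (hv : h.starDist v p < 1) (hw : h.starDist w p < 1) :
    v = w := by
  obtain ⟨e, c, τ, h1, h2, h3, h4, -⟩ := h.exists_coord_of_starDist_lt hv
  obtain ⟨e', c', τ', h1', h2', h3', h4', -⟩ := h.exists_coord_of_starDist_lt hw
  rw [h4] at hv
  rw [h4'] at hw
  have l1 := abs_lt.1 (by linarith : |(c : ℝ) - τ| < 1 / 4)
  have l2 := abs_lt.1 (by linarith : |(c' : ℝ) - τ'| < 1 / 4)
  by_cases hne : (e, c) = (e', c')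
  · obtain ⟨rfl, rfl⟩ := Prod.mk.inj hne
    have : τ = τ' := by
      rcases h2 with rfl | rfl <;> rcases h2' with rfl | rfl <;> try rfl
      all_goals norm_num at l1 l2; linarith
    rw [← h3, ← h3', this]
  · have key : ∀ {e e' : E} {c c' τ : I}, Φ (e, c) = Φ (e', c') → (e, c) ≠ (e', c') →
        (τ = 0 ∨ τ = 1) → -(1 / 4) < (c : ℝ) - τ ∧ (c : ℝ) - τ < 1 / 4 → c = τ := by
      intro e e' c c' τ h1 hne h2 l1
      have := h.endpoint_of_ne h1 hne
      simp only at this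
      rcases this with rfl | rfl <;> rcases h2 with rfl | rfl <;> try rfl
      all_goals norm_num at l1
    rw [← h3, ← h3', ← key (h1.trans h1'.symm) hne h2 l1,
      ← key (h1'.trans h1.symm) (Ne.symm hne) h2' l2, h1, h1']

theorem starDist_contract_le {v p : Γ} (hp : h.starDist v p < 1) (s : I) :
    h.starDist v (h.contract v p s) ≤ h.starDist v p := by
  obtain ⟨e, c, τ, h1, h2, h3, h4, h5⟩ := h.exists_coord_of_starDist_lt hp
  have hs0 := s.2.1
  have hs1 := s.2.2
  have hmem : (1 - s : ℝ) * c + s * τ ∈ Set.Icc (0 : ℝ) 1 :=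
    (convex_Icc (0 : ℝ) 1) c.2 τ.2 (by linarith) hs0 (by ring)
  rw [h5, edge_of_mem Φ e hmem, h4]
  refine (h.starDist_le h2 h3 _).trans ?_
  have : (1 - s : ℝ) * c + s * τ - τ = (1 - s) * (c - τ) := by ring
  simp only [this, abs_mul, abs_of_nonneg (by linarith : (0 : ℝ) ≤ 1 - s)]
  have := abs_nonneg ((c : ℝ) - τ)
  nlinarith

end IsGraphModel

/-! ### Decided configurations and their equivariant deformation. -/

theorem card_subtype_lt_card_subtype {α : Type*} [Finite α] {p q : α → Prop}
    (hpq : ∀ a, p a → q a) {a : α} (ha : q a) (hn : ¬ p a) :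
    Nat.card {a // p a} < Nat.card {a // q a} := by
  have : {a | p a}.ncard < {a | q a}.ncard :=
    Set.ncard_lt_ncard ⟨hpq, fun hsub => hn (hsub ha)⟩ (Set.toFinite _)
  rwa [← Nat.card_coe_set_eq, ← Nat.card_coe_set_eq] at this

theorem interp_mem {c s : I} {y : ℝ} (h0 : 0 < y) (h1 : y < 1) :
    (1 - s : ℝ) * c + s * y ∈ Set.Icc (0 : ℝ) 1 :=
  convex_Icc (0 : ℝ) 1 c.2 ⟨h0.le, h1.le⟩ (by linarith [s.2.2]) s.2.1 (by ring)

/-- At positive times a free particle is interior to its edge, so its coordinates are unique and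
collisions can be tested on coordinates. -/
theorem interp_interior {c s : I} {y : ℝ} (hs : 0 < s) (h0 : 0 < y) (h1 : y < 1) :
    0 < (1 - s : ℝ) * c + s * y ∧ (1 - s : ℝ) * c + s * y < 1 := by
  have hs' : (0 : ℝ) < s := hs
  have h2 := s.2.2
  have h3 := c.2.1
  have h4 := c.2.2
  constructor <;> nlinarith [mul_pos hs' h0, mul_pos hs' (sub_pos.2 h1),
    mul_nonneg (sub_nonneg.2 h2) h3, mul_nonneg (sub_nonneg.2 h2) (sub_nonneg.2 h4)]

namespace IsGraphModel

variable {E Γ : Type*} [TopologicalSpace E] [DiscreteTopology E] [Finite E]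
  [TopologicalSpace Γ] {Φ : E × I → Γ} (h : IsGraphModel Φ) {k : ℕ}

/-- The `i`-th particle is near `v`, and closer to `v` than all other particles by the
factor `t`. -/
def Near (t : ℝ) (v : Γ) (x : OrderedConf k Γ) (i : Fin k) : Prop :=
  h.starDist v (x.1 i) < t ∧ ∀ j ≠ i, h.starDist v (x.1 i) < t * h.starDist v (x.1 j)

/-- No particle is close to being near `v`. -/
def Far (t : ℝ) (v : Γ) (x : OrderedConf k Γ) : Prop :=
  ∀ i, t < h.starDist v (x.1 i) ∨ ∃ j ≠ i, t * h.starDist v (x.1 j) < h.starDist v (x.1 i)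

variable (k) in
/-- The configurations which at every branch point are decidedly near or far. -/
def decidedSet (t : ℝ) : Set (OrderedConf k Γ) :=
  {x | ∀ v ∈ (regularSet Φ)ᶜ, (∃ i, h.Near t v x i) ∨ h.Far t v x}

/-- A particle is free if it is not near any branch point. -/
def Free (t : ℝ) (x : OrderedConf k Γ) (i : Fin k) : Prop :=
  ∀ v ∈ (regularSet Φ)ᶜ, ¬ h.Near t v x i

include h

variable {h} {t : ℝ} {v : Γ} {x : OrderedConf k Γ} {i j : Fin k}

theorem Near.unique (ht : t ≤ 1) (hi : h.Near t v x i) (hj : h.Near t v x j) : i = j := by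
  by_contra hne
  have h1 := hi.2 j (Ne.symm hne)
  have h2 := hj.2 i hne
  have := h.starDist_nonneg v (x.1 i)
  have := h.starDist_nonneg v (x.1 j)
  nlinarith

theorem Near.not_far (hi : h.Near t v x i) : ¬ h.Far t v x := by
  intro hf
  rcases hf i with hf | ⟨j, hj, hf⟩
  · exact lt_asymm hf hi.1
  · exact lt_asymm hf (hi.2 j hj)

theorem Near.starDist_lt_one (ht : t ≤ 1) (hi : h.Near t v x i) : h.starDist v (x.1 i) < 1 :=
  hi.1.trans_le ht

theorem Near.eq {w : Γ} (ht : t ≤ 1) (hv : h.Near t v x i) (hw : h.Near t w x i) : v = w :=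
  h.eq_of_starDist_lt (hv.starDist_lt_one ht) (hw.starDist_lt_one ht)

variable (h)

section Open

variable [T2Space Γ]

theorem continuous_starDist_apply (v : Γ) (i : Fin k) :
    Continuous fun x : OrderedConf k Γ => h.starDist v (x.1 i) :=
  (h.continuous_starDist v).comp ((continuous_apply i).comp continuous_subtype_val)

theorem isOpen_near (t : ℝ) (v : Γ) (i : Fin k) : IsOpen {x | h.Near t v x i} := by
  have hc := fun i : Fin k => h.continuous_starDist_apply v i
  have : {x | h.Near t v x i} = {x | h.starDist v (x.1 i) < t} ∩
      ⋂ j, ⋂ (_ : j ≠ i), {x | h.starDist v (x.1 i) < t * h.starDist v (x.1 j)} := by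
    ext x; simp [Near]
  rw [this]
  exact (isOpen_lt (hc i) continuous_const).inter (isOpen_iInter_of_finite fun j =>
    isOpen_iInter_of_finite fun _ => isOpen_lt (hc i) (continuous_const.mul (hc j)))

theorem isOpen_far (t : ℝ) (v : Γ) : IsOpen {x : OrderedConf k Γ | h.Far t v x} := by
  have hc := fun i : Fin k => h.continuous_starDist_apply v i
  have : {x : OrderedConf k Γ | h.Far t v x} = ⋂ i, ({x | t < h.starDist v (x.1 i)} ∪
      ⋃ j, ⋃ (_ : j ≠ i), {x | t * h.starDist v (x.1 j) < h.starDist v (x.1 i)}) := by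
    ext x; simp [Far]
  rw [this]
  exact isOpen_iInter_of_finite fun i => (isOpen_lt continuous_const (hc i)).union
    (isOpen_iUnion fun j => isOpen_iUnion fun _ => isOpen_lt (continuous_const.mul (hc j)) (hc i))

theorem isOpen_decidedSet (t : ℝ) : IsOpen (h.decidedSet k t) := by
  have : h.decidedSet k t = ⋂ v ∈ (regularSet Φ)ᶜ,
      ((⋃ i, {x | h.Near t v x i}) ∪ {x : OrderedConf k Γ | h.Far t v x}) := by
    ext x; simp [decidedSet]
  rw [this]
  exact h.finite_compl_regularSet.isOpen_biInter fun v _ =>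
    (isOpen_iUnion fun i => h.isOpen_near t v i).union (h.isOpen_far t v)

end Open

/-- A branch point at which `x` is undecided is assigned to each bad threshold, and this assignment
is injective: the failure of `Far` yields a particle satisfying the inequalities of `Near` weakly,
and for any larger threshold they become strict. -/
theorem ncard_notMem_decidedSet_le {n : ℕ} {t : Fin n → ℝ} (ht : StrictMono t)
    (x : OrderedConf k Γ) :
    {l | x ∉ h.decidedSet k (t l)}.ncard ≤ (regularSet Φ)ᶜ.ncard := by
  have hex : ∀ l ∈ {l | x ∉ h.decidedSet k (t l)}, ∃ v ∈ (regularSet Φ)ᶜ,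
      ¬ ((∃ i, h.Near (t l) v x i) ∨ h.Far (t l) v x) := by
    intro l hl
    by_contra! hcon
    exact hl fun v hv => hcon v hv
  rcases Set.eq_empty_or_nonempty {l | x ∉ h.decidedSet k (t l)} with he | ⟨l₀, hl₀⟩
  · simp [he]
  have : Nonempty Γ := ⟨(hex l₀ hl₀).choose⟩
  choose! f hf hnot using hex
  refine Set.ncard_le_ncard_of_injOn f hf ?_ h.finite_compl_regularSet
  have key : ∀ l ∈ {l | x ∉ h.decidedSet k (t l)}, ∀ l' ∈ {l | x ∉ h.decidedSet k (t l)},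
      f l = f l' → ¬ l < l' := by
    intro l hl l' hl' hv hlt
    have h1 := hnot l hl
    have h2 := hnot l' hl'
    rw [← hv] at h2
    set v := f l
    have hv' := hf l hl
    have htt := ht hlt
    simp only [not_or, Far, not_forall, not_exists, not_lt, not_and] at h1
    obtain ⟨-, i, h1, h3⟩ := h1
    refine h2 (Or.inl ⟨i, by linarith, fun j hj => ?_⟩)
    -- Strictness needs the other distances to be nonzero: otherwise particles `i` and `j` would
    -- both sit at `v`.
    have hpos : 0 < h.starDist v (x.1 j) := by
      refine lt_of_le_of_ne (h.starDist_nonneg _ _) fun h0 => hj ?_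
      have h4 := h3 j hj
      rw [← h0, mul_zero] at h4
      have h5 := h.eq_of_starDist_eq_zero (le_antisymm h4 (h.starDist_nonneg _ _))
      exact x.2 ((h.eq_of_starDist_eq_zero h0.symm).trans h5.symm)
    have := h3 j hj
    nlinarith
  intro l hl l' hl' heq
  exact le_antisymm (not_lt.1 (key l' hl' l hl heq.symm)) (not_lt.1 (key l hl l' hl' heq))

variable {h}

/-- A particle at a branch point has distance zero to it, which rules out `Far` and prevents any
other particle from being near. In a decided configuration it is therefore itself near, not free. -/
theorem Free.mem_regularSet (ht : 0 < t) (hx : x ∈ h.decidedSet k t) (hi : h.Free t x i) :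
    x.1 i ∈ regularSet Φ := by
  by_contra hv
  have h0 := h.starDist_self hv
  rcases hx _ hv with ⟨j, hj⟩ | hf
  · have hne : i ≠ j := by rintro rfl; exact hi _ hv hj
    have h1 := hj.2 i hne
    rw [h0, mul_zero] at h1
    exact absurd h1 (not_lt.2 (h.starDist_nonneg _ _))
  · rcases hf i with h1 | ⟨j, -, h1⟩
    · rw [h0] at h1; linarith
    · rw [h0] at h1
      have := h.starDist_nonneg (x.1 i) (x.1 j)
      nlinarith

variable (h)

/-- The number of free particles below the `i`-th one on the same edge. -/
noncomputable def rankBelow (t : ℝ) (x : OrderedConf k Γ) (i : Fin k) : ℕ :=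
  Nat.card {j // h.Free t x j ∧ (h.coord (x.1 j)).1 = (h.coord (x.1 i)).1 ∧
    (h.coord (x.1 j)).2 < (h.coord (x.1 i)).2}

/-- The number of free particles on the edge of the `i`-th one. -/
noncomputable def edgeCount (t : ℝ) (x : OrderedConf k Γ) (i : Fin k) : ℕ :=
  Nat.card {j // h.Free t x j ∧ (h.coord (x.1 j)).1 = (h.coord (x.1 i)).1}

/-- The position to which the free particle `i` moves. -/
noncomputable def target (t : ℝ) (x : OrderedConf k Γ) (i : Fin k) : ℝ :=
  ((h.rankBelow t x i : ℝ) + 1) / ((h.edgeCount t x i : ℝ) + 1)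

open Classical in
/-- The deformation: particles near a branch point move there, and free particles move within
their edges to equidistant positions. -/
noncomputable def motion (t : ℝ) (x : OrderedConf k Γ) (i : Fin k) (s : I) : Γ :=
  if hn : ∃ v ∈ (regularSet Φ)ᶜ, h.Near t v x i then h.contract hn.choose (x.1 i) s
  else edge Φ (h.coord (x.1 i)).1 ((1 - s) * (h.coord (x.1 i)).2 + s * h.target t x i)

variable {h}

theorem motion_of_near (ht : t ≤ 1) (hv : v ∈ (regularSet Φ)ᶜ) (hi : h.Near t v x i) (s : I) :
    h.motion t x i s = h.contract v (x.1 i) s := by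
  have hn : ∃ v ∈ (regularSet Φ)ᶜ, h.Near t v x i := ⟨v, hv, hi⟩
  rw [motion, dif_pos hn, hn.choose_spec.2.eq ht hi]

theorem motion_of_free (hi : h.Free t x i) (s : I) :
    h.motion t x i s =
      edge Φ (h.coord (x.1 i)).1 ((1 - s) * (h.coord (x.1 i)).2 + s * h.target t x i) := by
  rw [motion, dif_neg]
  rintro ⟨v, hv, hn⟩
  exact hi v hv hn

variable (h) in
theorem near_or_free (t : ℝ) (x : OrderedConf k Γ) (i : Fin k) :
    (∃ v ∈ (regularSet Φ)ᶜ, h.Near t v x i) ∨ h.Free t x i := by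
  by_cases hn : ∃ v ∈ (regularSet Φ)ᶜ, h.Near t v x i
  · exact Or.inl hn
  · exact Or.inr fun v hv hi => hn ⟨v, hv, hi⟩

variable (h) in
theorem target_pos (t : ℝ) (x : OrderedConf k Γ) (i : Fin k) :
    0 < h.target t x i := by unfold target; positivity

theorem target_lt_one (hi : h.Free t x i) : h.target t x i < 1 := by
  have hlt : h.rankBelow t x i < h.edgeCount t x i := by
    exact card_subtype_lt_card_subtype (fun j hj => ⟨hj.1, hj.2.1⟩) (a := i) ⟨hi, rfl⟩
      fun hj => lt_irrefl _ hj.2.2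
  unfold target
  rw [div_lt_one (by positivity)]
  have : (h.rankBelow t x i : ℝ) < h.edgeCount t x i := by exact_mod_cast hlt
  linarith

/-- The target of a free particle is its rank among equally spaced interior positions of its edge,
so targets are ordered as the particles are. -/
theorem target_lt_target (hi : h.Free t x i)
    (he : (h.coord (x.1 i)).1 = (h.coord (x.1 j)).1)
    (hc : (h.coord (x.1 i)).2 < (h.coord (x.1 j)).2) : h.target t x i < h.target t x j := by
  have hlt : h.rankBelow t x i < h.rankBelow t x j := by
    exact card_subtype_lt_card_subtype
      (fun l hl => ⟨hl.1, hl.2.1.trans he, hl.2.2.trans hc⟩) (a := i) ⟨hi, he, hc⟩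
      fun hj => lt_irrefl _ hj.2.2
  have heq : h.edgeCount t x i = h.edgeCount t x j := by unfold edgeCount; rw [he]
  unfold target
  rw [heq]
  have : (h.rankBelow t x i : ℝ) < h.rankBelow t x j := by exact_mod_cast hlt
  gcongr

theorem motion_zero (ht : t ≤ 1) (i : Fin k) : h.motion t x i 0 = x.1 i := by
  rcases h.near_or_free t x i with ⟨v, hv, hi⟩ | hi
  · obtain ⟨e, c, τ, h1, -, -, -, h2⟩ := h.exists_coord_of_starDist_lt (hi.starDist_lt_one ht)
    rw [motion_of_near ht hv hi, h2]
    simp [edge_coe, h1]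
  · rw [motion_of_free hi]
    simp [edge_coe, h.apply_coord]

/-- A collision would happen inside an edge ending at `v`. On it the near particle starts closer to
that end and moves towards it, while the free one heads for an interior target, so their order
persists. -/
theorem motion_ne_of_near_of_free (ht : t ≤ 1) {s : I} (hs : 0 < s)
    (hv : v ∈ (regularSet Φ)ᶜ) (hi : h.Near t v x i) (hj : h.Free t x j) :
    h.motion t x i s ≠ h.motion t x j s := by
  intro heq
  have hne : j ≠ i := by rintro rfl; exact hj v hv hi
  obtain ⟨e, c, τ, h1, h2, h3, h4, h5⟩ :=
    h.exists_coord_of_starDist_lt (hi.starDist_lt_one ht)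
  have hy0 := h.target_pos t x j
  have hy1 := target_lt_one hj
  have hτ : (1 - s : ℝ) * c + s * τ ∈ Set.Icc (0 : ℝ) 1 :=
    convex_Icc (0 : ℝ) 1 c.2 τ.2 (by linarith [s.2.2]) s.2.1 (by ring)
  have hint := interp_interior (c := (h.coord (x.1 j)).2) hs hy0 hy1
  rw [motion_of_near ht hv hi, h5, motion_of_free hj, edge_of_mem Φ e hτ,
    edge_of_mem Φ _ (interp_mem hy0 hy1)] at heq
  obtain ⟨he, hc⟩ := Prod.mk.inj (h.eq_of_interior _ _ _ hint.1 hint.2 heq)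
  have hc' := congrArg Subtype.val hc
  simp only at hc'
  have hd := hi.2 j hne
  have hxj : x.1 j = Φ (e, (h.coord (x.1 j)).2) := by
    conv_lhs => rw [← h.apply_coord (x.1 j)]
    rw [he]
  have hle := h.starDist_le h2 h3 (h.coord (x.1 j)).2
  rw [← hxj] at hle
  have hnn := h.starDist_nonneg v (x.1 j)
  -- The star distance of the near particle is exactly `4 * |c - τ|`; that of the free one is at
  -- most the corresponding expression, because the edge may also end at `v` on its other side.
  have hlt : |(c : ℝ) - τ| < |((h.coord (x.1 j)).2 : ℝ) - τ| := by nlinarith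
  have hs' : (0 : ℝ) < s := hs
  have hs1 := s.2.2
  rcases h2 with rfl | rfl
  · simp only [Set.Icc.coe_zero, sub_zero, abs_of_nonneg c.2.1,
      abs_of_nonneg (h.coord (x.1 j)).2.2.1] at hlt hc'
    nlinarith [mul_pos hs' hy0]
  · simp only [Set.Icc.coe_one] at hlt hc'
    rw [abs_of_nonpos (by linarith [c.2.2]),
      abs_of_nonpos (by linarith [(h.coord (x.1 j)).2.2.2])] at hlt
    nlinarith [mul_pos hs' (sub_pos.2 hy1)]

/-- Near particles stay in disjoint stars, one particle per star; free particles on one edge keep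
their order under interpolation; a near and a free particle never meet. -/
theorem motion_injective (ht : t ≤ 1) (x : OrderedConf k Γ) (s : I) :
    Function.Injective fun i => h.motion t x i s := by
  -- Time zero is separate, since a free particle may start at an unglued end of an edge.
  rcases eq_or_lt_of_le s.2.1 with hs | hs
  · have : s = 0 := Subtype.ext hs.symm
    subst this
    simpa only [motion_zero ht] using x.2
  have hs : 0 < s := hs
  intro i j heq
  simp only at heq
  rcases h.near_or_free t x i with ⟨v, hv, hi⟩ | hi <;>
    rcases h.near_or_free t x j with ⟨w, hw, hj⟩ | hj
  · have h1 := (h.starDist_contract_le (hi.starDist_lt_one ht) s).trans_lt (hi.starDist_lt_one ht)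
    have h2 := (h.starDist_contract_le (hj.starDist_lt_one ht) s).trans_lt (hj.starDist_lt_one ht)
    rw [← motion_of_near ht hv hi, heq] at h1
    rw [← motion_of_near ht hw hj] at h2
    obtain rfl := h.eq_of_starDist_lt h1 h2
    exact hi.unique ht hj
  · exact absurd heq (motion_ne_of_near_of_free ht hs hv hi hj)
  · exact absurd heq.symm (motion_ne_of_near_of_free ht hs hw hj hi)
  · have hi0 := h.target_pos t x i
    have hi1 := target_lt_one hi
    have hj0 := h.target_pos t x j
    have hj1 := target_lt_one hj
    have hint := interp_interior (c := (h.coord (x.1 j)).2) hs hj0 hj1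
    rw [motion_of_free hi, motion_of_free hj, edge_of_mem Φ _ (interp_mem hi0 hi1),
      edge_of_mem Φ _ (interp_mem hj0 hj1)] at heq
    obtain ⟨he, hc⟩ := Prod.mk.inj (h.eq_of_interior _ _ _ hint.1 hint.2 heq)
    have hc' := congrArg Subtype.val hc
    simp only at hc'
    have hs' : (0 : ℝ) < s := hs
    have hs1 := s.2.2
    rcases lt_trichotomy (h.coord (x.1 i)).2 (h.coord (x.1 j)).2 with hlt | hlt | hlt
    · have := target_lt_target hi he hlt
      have hlt' : ((h.coord (x.1 i)).2 : ℝ) < (h.coord (x.1 j)).2 := hlt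
      nlinarith
    · apply x.2
      rw [← h.apply_coord (x.1 i), ← h.apply_coord (x.1 j)]
      exact congrArg Φ (Prod.ext he hlt)
    · have := target_lt_target hj he.symm hlt
      have hlt' : ((h.coord (x.1 j)).2 : ℝ) < (h.coord (x.1 i)).2 := hlt
      nlinarith

section Relabel

variable (π : Equiv.Perm (Fin k))

theorem near_relabel : h.Near t v (x.relabel π) i ↔ h.Near t v x (π i) := by
  refine and_congr Iff.rfl ⟨fun hj j hne => ?_, fun hj j hne => hj _ (π.injective.ne hne)⟩
  have := hj (π.symm j) (fun he => hne (by rw [← he]; simp))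
  simpa using this

theorem far_relabel : h.Far t v (x.relabel π) ↔ h.Far t v x := by
  constructor
  · intro hf i
    rcases hf (π.symm i) with h1 | ⟨j, hj, h1⟩
    · left; simpa using h1
    · right
      exact ⟨π j, fun he => hj (by rw [← he]; simp), by simpa using h1⟩
  · intro hf i
    rcases hf (π i) with h1 | ⟨j, hj, h1⟩
    · left; exact h1
    · right
      exact ⟨π.symm j, fun he => hj (by rw [← he]; simp), by simpa using h1⟩

theorem free_relabel : h.Free t (x.relabel π) i ↔ h.Free t x (π i) :=
  forall₂_congr fun _ _ => not_congr (near_relabel π)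

theorem relabel_mem_decidedSet (hx : x ∈ h.decidedSet k t) :
    x.relabel π ∈ h.decidedSet k t := by
  intro v hv
  rcases hx v hv with ⟨i, hi⟩ | hf
  · exact Or.inl ⟨π.symm i, (near_relabel π).2 (by simpa using hi)⟩
  · exact Or.inr ((far_relabel π).2 hf)

theorem target_relabel : h.target t (x.relabel π) i = h.target t x (π i) := by
  have h1 : h.rankBelow t (x.relabel π) i = h.rankBelow t x (π i) :=
    Nat.card_congr (π.subtypeEquiv fun j => by rw [free_relabel]; rfl)
  have h2 : h.edgeCount t (x.relabel π) i = h.edgeCount t x (π i) :=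
    Nat.card_congr (π.subtypeEquiv fun j => by rw [free_relabel]; rfl)
  rw [target, target, h1, h2]

theorem motion_relabel (ht : t ≤ 1) (s : I) :
    h.motion t (x.relabel π) i s = h.motion t x (π i) s := by
  rcases h.near_or_free t x (π i) with ⟨v, hv, hi⟩ | hi
  · rw [motion_of_near ht hv hi, motion_of_near ht hv ((near_relabel π).2 hi)]
    rfl
  · rw [motion_of_free hi, motion_of_free ((free_relabel π).2 hi), target_relabel]
    rfl

end Relabel

section Continuity

variable [T2Space Γ]

/-- At each branch point one of the open, mutually exclusive conditions holds at `x`, and it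
persists nearby. Hence the pattern of near particles is locally constant. -/
theorem eventually_near_iff (ht : t ≤ 1) (hx : x ∈ h.decidedSet k t) :
    ∀ᶠ y in 𝓝 x, ∀ v ∈ (regularSet Φ)ᶜ, ∀ i, h.Near t v y i ↔ h.Near t v x i := by
  rw [Filter.eventually_all_finite h.finite_compl_regularSet]
  intro v hv
  rcases hx v hv with ⟨i, hi⟩ | hf
  · filter_upwards [(h.isOpen_near t v i).mem_nhds hi] with y hy j
    constructor
    · intro hj
      rw [hj.unique ht hy]; exact hi
    · intro hj
      rw [hj.unique ht hi]; exact hy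
  · filter_upwards [(h.isOpen_far t v).mem_nhds hf] with y hy j
    exact ⟨fun hj => absurd hy hj.not_far, fun hj => absurd hf hj.not_far⟩

theorem eventually_free_iff (ht : t ≤ 1) (hx : x ∈ h.decidedSet k t) :
    ∀ᶠ y in 𝓝 x, ∀ i, h.Free t y i ↔ h.Free t x i := by
  filter_upwards [eventually_near_iff ht hx] with y hy i
  exact forall₂_congr fun v hv => not_congr (hy v hv i)

theorem Free.continuousAt_coord (h0 : 0 < t) (hx : x ∈ h.decidedSet k t) (hi : h.Free t x i) :
    ContinuousAt (fun y : OrderedConf k Γ => h.coord (y.1 i)) x :=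
  ContinuousAt.comp' (f := fun y : OrderedConf k Γ => y.1 i)
    (h.continuousAt_coord (hi.mem_regularSet h0 hx))
    ((continuous_apply i).comp continuous_subtype_val).continuousAt

theorem Free.eventually_edge_eq (h0 : 0 < t) (hx : x ∈ h.decidedSet k t) (hi : h.Free t x i) :
    ∀ᶠ y in 𝓝 x, (h.coord (y.1 i)).1 = (h.coord (x.1 i)).1 := by
  have := (continuous_fst.continuousAt.comp (hi.continuousAt_coord h0 hx))
  exact this.eventually (mem_nhds_discrete.2 rfl : {(h.coord (x.1 i)).1} ∈ 𝓝 _)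

/-- The target depends only on which particles are free, on their edges and on their order along
them. All of these are locally constant, as free particles are at regular points, where coordinates
are continuous. -/
theorem eventually_target_eq (h0 : 0 < t) (ht : t ≤ 1) (hx : x ∈ h.decidedSet k t)
    (hi : h.Free t x i) : ∀ᶠ y in 𝓝 x, h.target t y i = h.target t x i := by
  have hedge : ∀ᶠ y in 𝓝 x, ∀ j, h.Free t x j →
      (h.coord (y.1 j)).1 = (h.coord (x.1 j)).1 := by
    rw [Filter.eventually_all]
    intro j
    by_cases hj : h.Free t x j
    · filter_upwards [hj.eventually_edge_eq h0 hx] with y hy _ using hy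
    · exact Filter.Eventually.of_forall fun y hj' => absurd hj' hj
  have hlt : ∀ᶠ y in 𝓝 x, ∀ j, h.Free t x j →
      (h.coord (x.1 j)).1 = (h.coord (x.1 i)).1 →
        ((h.coord (y.1 j)).2 < (h.coord (y.1 i)).2 ↔
          (h.coord (x.1 j)).2 < (h.coord (x.1 i)).2) := by
    rw [Filter.eventually_all]
    intro j
    by_cases hj : h.Free t x j ∧ (h.coord (x.1 j)).1 = (h.coord (x.1 i)).1
    · have ci := continuous_snd.continuousAt.comp (hi.continuousAt_coord h0 hx)
      have cj := continuous_snd.continuousAt.comp (hj.1.continuousAt_coord h0 hx)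
      rcases lt_trichotomy (h.coord (x.1 j)).2 (h.coord (x.1 i)).2 with hc | hc | hc
      · filter_upwards [cj.eventually_lt ci hc] with y hy _ _ using ⟨fun _ => hc, fun _ => hy⟩
      · have : j = i := by
          apply x.2
          rw [← h.apply_coord (x.1 i), ← h.apply_coord (x.1 j)]
          exact congrArg Φ (Prod.ext hj.2 hc)
        subst this
        exact Filter.Eventually.of_forall fun y _ _ => by simp
      · filter_upwards [ci.eventually_lt cj hc] with y hy _ _ using
          ⟨fun h1 => absurd hy h1.not_gt, fun h1 => absurd hc h1.not_gt⟩
    · exact Filter.Eventually.of_forall fun y h1 h2 => absurd ⟨h1, h2⟩ hj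
  filter_upwards [eventually_free_iff ht hx, hedge, hlt] with y hf he hl
  have h1 : h.rankBelow t y i = h.rankBelow t x i := by
    refine Nat.card_congr (Equiv.subtypeEquivRight fun j => ?_)
    rw [hf j]
    refine and_congr_right fun hj => ?_
    rw [he j hj, he i hi]
    exact and_congr_right fun hej => hl j hj hej
  have h2 : h.edgeCount t y i = h.edgeCount t x i := by
    refine Nat.card_congr (Equiv.subtypeEquivRight fun j => ?_)
    rw [hf j]
    refine and_congr_right fun hj => ?_
    rw [he j hj, he i hi]
  rw [target, target, h1, h2]

/-- At time one a near particle is at its branch point and a free one at its target, and both are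
determined by locally constant data. -/
theorem eventually_motion_one (h0 : 0 < t) (ht : t ≤ 1) (hx : x ∈ h.decidedSet k t)
    (i : Fin k) : ∀ᶠ y in 𝓝 x, h.motion t y i 1 = h.motion t x i 1 := by
  rcases h.near_or_free t x i with ⟨v, hv, hi⟩ | hi
  · have key : ∀ y : OrderedConf k Γ, h.Near t v y i → h.motion t y i 1 = v := by
      intro y hy
      obtain ⟨e, c, τ, h1, -, h2, -, h3⟩ := h.exists_coord_of_starDist_lt (hy.starDist_lt_one ht)
      rw [motion_of_near ht hv hy, h3]
      simp [edge_coe, h2]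
    filter_upwards [(h.isOpen_near t v i).mem_nhds hi] with y hy
    rw [key y hy, key x hi]
  · filter_upwards [eventually_free_iff ht hx, hi.eventually_edge_eq h0 hx,
      eventually_target_eq h0 ht hx hi] with y hf he ht
    rw [motion_of_free hi, motion_of_free ((hf i).2 hi), he, ht]
    simp

theorem continuousAt_motion (h0 : 0 < t) (ht : t ≤ 1) (hx : x ∈ h.decidedSet k t)
    (i : Fin k) (s : I) :
    ContinuousAt (fun p : I × OrderedConf k Γ => h.motion t p.2 i p.1) (s, x) := by
  have hsnd : Filter.Tendsto (Prod.snd : I × OrderedConf k Γ → _) (𝓝 (s, x)) (𝓝 x) :=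
    continuous_snd.continuousAt
  have hval : Continuous fun y : OrderedConf k Γ => y.1 i :=
    (continuous_apply i).comp continuous_subtype_val
  rcases h.near_or_free t x i with ⟨v, hv, hi⟩ | hi
  · have hc : Continuous fun p : I × OrderedConf k Γ => h.contract v (p.2.1 i) p.1 :=
      ((h.continuous_contract v).comp (hval.comp continuous_snd)).eval continuous_fst
    refine hc.continuousAt.congr ?_
    filter_upwards [hsnd.eventually ((h.isOpen_near t v i).mem_nhds hi)] with p hp
    exact (motion_of_near ht hv hp p.1).symm
  · have hc := (hi.continuousAt_coord h0 hx)
    have hc2 : ContinuousAt (fun p : I × OrderedConf k Γ => ((h.coord (p.2.1 i)).2 : ℝ)) (s, x) :=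
      ContinuousAt.comp' (g := fun y : OrderedConf k Γ => ((h.coord (y.1 i)).2 : ℝ))
        (f := fun p : I × OrderedConf k Γ => p.2)
        (continuous_subtype_val.continuousAt.comp (continuous_snd.continuousAt.comp hc)) hsnd
    have hs : ContinuousAt (fun p : I × OrderedConf k Γ => (p.1 : ℝ)) (s, x) := by fun_prop
    have hm : ContinuousAt (fun p : I × OrderedConf k Γ => edge Φ (h.coord (x.1 i)).1
        ((1 - p.1) * (h.coord (p.2.1 i)).2 + p.1 * h.target t x i)) (s, x) :=
      ContinuousAt.comp' (g := fun p : E × ℝ => edge Φ p.1 p.2)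
        (h.continuous_edge.continuousAt)
        (continuousAt_const.prodMk (((continuousAt_const.sub hs).mul hc2).add
          (hs.mul continuousAt_const)))
    refine hm.congr ?_
    filter_upwards [hsnd.eventually (eventually_free_iff ht hx),
      hsnd.eventually (hi.eventually_edge_eq h0 hx),
      hsnd.eventually (eventually_target_eq h0 ht hx hi)] with p hf he ht
    rw [motion_of_free ((hf i).2 hi), he, ht]

variable (h)

/-- The equivariant deformation of the set of decided configurations to a locally constant map. -/
theorem exists_deformation (k : ℕ) {t : ℝ} (h0 : 0 < t) (ht : t ≤ 1) :
    ∃ H : I × h.decidedSet k t → OrderedConf k Γ, Continuous H ∧ (∀ u, H (0, u) = u) ∧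
      (∀ u, ∀ᶠ w in 𝓝 u, H (1, w) = H (1, u)) ∧
      ∀ s (u : h.decidedSet k t) π,
        H (s, ⟨u.1.relabel π, relabel_mem_decidedSet π u.2⟩) = (H (s, u)).relabel π := by
  refine ⟨fun p => ⟨fun i => h.motion t p.2.1 i p.1, motion_injective ht _ _⟩, ?_, ?_, ?_, ?_⟩
  · refine Continuous.subtype_mk (continuous_pi fun i => ?_) _
    rw [continuous_iff_continuousAt]
    rintro ⟨s, u⟩
    have hc : Continuous fun p : I × h.decidedSet k t => (p.1, p.2.1) := by fun_prop
    exact ContinuousAt.comp' (x := (s, u)) (f := fun p : I × h.decidedSet k t => (p.1, p.2.1))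
      (continuousAt_motion h0 ht u.2 i s) hc.continuousAt
  · intro u
    exact Subtype.ext (funext fun i => motion_zero ht i)
  · intro u
    have : ∀ᶠ y in 𝓝 u.1, ∀ i, h.motion t y i 1 = h.motion t u.1 i 1 := by
      rw [Filter.eventually_all]
      exact fun i => eventually_motion_one h0 ht u.2 i
    filter_upwards [continuous_subtype_val.continuousAt.eventually this] with w hw
    exact Subtype.ext (funext hw)
  · intro s u π
    exact Subtype.ext (funext fun i => motion_relabel π ht s)

end Continuity

end IsGraphModel

/-! ### Elementary paths in configuration spaces. -/

section Moves

variable {X : Type*} [TopologicalSpace X] {k : ℕ}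

/-- A motion of a single particle that avoids the other particles. -/
theorem joined_of_joinedIn {x y : OrderedConf k X} (i : Fin k) (hxy : ∀ j ≠ i, y.1 j = x.1 j)
    (hJ : JoinedIn {p | ∀ j ≠ i, p ≠ x.1 j} (x.1 i) (y.1 i)) : Joined x y := by
  obtain ⟨γ, hγ⟩ := hJ
  have hinj : ∀ s, Function.Injective (Function.update x.1 i (γ s)) := by
    intro s a b hab
    by_cases ha : a = i <;> by_cases hb : b = i
    · rw [ha, hb]
    · subst ha
      rw [Function.update_self, Function.update_of_ne hb] at hab
      exact absurd hab (hγ s b hb)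
    · subst hb
      rw [Function.update_self, Function.update_of_ne ha] at hab
      exact absurd hab.symm (hγ s a ha)
    · rw [Function.update_of_ne ha, Function.update_of_ne hb] at hab
      exact x.2 hab
  refine ⟨⟨⟨fun s => ⟨Function.update x.1 i (γ s), hinj s⟩, ?_⟩, ?_, ?_⟩⟩
  · exact Continuous.subtype_mk (continuous_const.update i γ.continuous) _
  · apply Subtype.ext
    simp
  · apply Subtype.ext
    funext j
    by_cases hj : j = i
    · subst hj; simp
    · simp [hj, hxy j hj]

/-- Two configurations on an embedded interval with the same order of particles are joined. -/
theorem joined_of_strictMono {f : ℝ → X} (hf : Continuous f) {J : Set ℝ} (hJ : Convex ℝ J)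
    (hinj : Set.InjOn f J) {c d : Fin k → ℝ} (hc : StrictMono c) (hd : StrictMono d)
    (hcJ : ∀ i, c i ∈ J) (hdJ : ∀ i, d i ∈ J) {x y : OrderedConf k X}
    (hx : ∀ i, x.1 i = f (c i)) (hy : ∀ i, y.1 i = f (d i)) : Joined x y := by
  have hmem : ∀ (s : I) i, (1 - s : ℝ) * c i + s * d i ∈ J := fun s i =>
    hJ (hcJ i) (hdJ i) (by linarith [s.2.2]) s.2.1 (by ring)
  have hmono : ∀ s : I, StrictMono fun i => (1 - s : ℝ) * c i + s * d i := by
    intro s i j hij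
    have h1 := hc hij
    have h2 := hd hij
    have h3 := s.2.1
    have h4 := s.2.2
    rcases eq_or_lt_of_le h3 with h0 | h0
    · simp only [← h0]; linarith
    · have := mul_lt_mul_of_pos_left h2 h0
      have := mul_le_mul_of_nonneg_left h1.le (sub_nonneg.2 h4)
      simp only; linarith
  refine ⟨⟨⟨fun s => ⟨fun i => f ((1 - s) * c i + s * d i), fun i j hij =>
    (hmono s).injective (hinj (hmem s i) (hmem s j) hij)⟩, ?_⟩, ?_, ?_⟩⟩
  · refine Continuous.subtype_mk (continuous_pi fun i => hf.comp (by fun_prop)) _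
  · apply Subtype.ext
    funext i
    simp [hx]
  · apply Subtype.ext
    funext i
    simp [hy]

end Moves

/-! ### Sorting labelled particles with three stacks. -/

section Stacks

/-- Particles stacked on three legs: the leg and the height of each particle. -/
structure LegState (k : ℕ) where
  leg : Fin k → Fin 3
  height : Fin k → ℝ
  height_mem : ∀ i, height i ∈ Set.Ioo (0 : ℝ) (1 / 4)
  injective : Function.Injective fun i => (leg i, height i)

variable {k : ℕ}

/-- The lowest particle of a stack moves to the bottom of another stack. -/
def LegState.Move (S S' : LegState k) : Prop :=
  ∃ i, (∀ j ≠ i, S'.leg j = S.leg j ∧ S'.height j = S.height j) ∧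
    (∀ j ≠ i, S.leg j = S.leg i → S.height i < S.height j) ∧
    ∀ j ≠ i, S.leg j = S'.leg i → S'.height i < S.height j

theorem exists_pos_lt_of_finite {ι : Type*} [Finite ι] {f : ι → ℝ} (hf : ∀ i, 0 < f i) :
    ∃ δ > 0, ∀ i, δ < f i := by
  rcases isEmpty_or_nonempty ι with hi | hi
  · exact ⟨1, one_pos, fun i => (hi.false i).elim⟩
  · obtain ⟨i, hmin⟩ := Finite.exists_min f
    exact ⟨f i / 2, half_pos (hf i), fun j => (half_lt_self (hf i)).trans_le (hmin j)⟩

/-- The particles of `T` form the bottom of stack `p`, so they can leave one at a time, lowest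
first, each going below everything else on stack `q`. -/
theorem LegState.exists_transfer {p q : Fin 3} (hpq : p ≠ q) {δ : ℝ} (hδ : 0 < δ) :
    ∀ (n : ℕ) (S : LegState k) (T : Finset (Fin k)), T.card = n → (∀ i ∈ T, S.leg i = p) →
      (∀ i ∈ T, ∀ j, S.leg j = p → j ∉ T → S.height i < S.height j) →
      ∃ S' : LegState k, Relation.ReflTransGen LegState.Move S S' ∧
        (∀ i ∈ T, S'.leg i = q ∧ S'.height i < δ) ∧
        ∀ i ∉ T, S'.leg i = S.leg i ∧ S'.height i = S.height i := by
  classical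
  intro n
  induction n with
  | zero =>
    intro S T hT _ _
    obtain rfl := Finset.card_eq_zero.1 hT
    exact ⟨S, .refl, by simp, by simp⟩
  | succ n ih =>
    intro S T hT hp hdown
    obtain ⟨i, hi, hmin⟩ := T.exists_min_image S.height (Finset.card_pos.1 (by omega))
    obtain ⟨d, hd0, hd⟩ := exists_pos_lt_of_finite fun j => (S.height_mem j).1
    -- The new height lies below every current height on all legs, so the moved particle lands at
    -- the bottom and heights stay distinct.
    obtain ⟨d', hd'0, hd'δ, hd'd⟩ : ∃ d' > 0, d' < δ ∧ d' < d :=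
      ⟨min δ d / 2, by positivity,
        (half_lt_self (lt_min hδ hd0)).trans_le (min_le_left _ _),
        (half_lt_self (lt_min hδ hd0)).trans_le (min_le_right _ _)⟩
    have hlt : ∀ j, d' < S.height j := fun j => hd'd.trans (hd j)
    let S₁ : LegState k :=
      { leg := Function.update S.leg i q
        height := Function.update S.height i d'
        height_mem := by
          intro j
          by_cases hj : j = i
          · subst hj
            rw [Function.update_self]
            exact ⟨hd'0, (hlt j).trans (S.height_mem j).2⟩
          · rw [Function.update_of_ne hj]
            exact S.height_mem j
        injective := by
          intro a b hab
          simp only [Prod.mk.injEq] at hab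
          by_cases ha : a = i <;> by_cases hb : b = i
          · rw [ha, hb]
          · subst ha
            rw [Function.update_self, Function.update_of_ne hb,
              Function.update_self, Function.update_of_ne hb] at hab
            exact absurd hab.2 (hlt b).ne
          · subst hb
            rw [Function.update_self, Function.update_of_ne ha,
              Function.update_self, Function.update_of_ne ha] at hab
            exact absurd hab.2 (hlt a).ne'
          · rw [Function.update_of_ne ha, Function.update_of_ne hb,
              Function.update_of_ne ha, Function.update_of_ne hb] at hab
            exact S.injective (Prod.ext hab.1 hab.2) }
    have hS₁ : ∀ j ≠ i, S₁.leg j = S.leg j ∧ S₁.height j = S.height j := fun j hj =>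
      ⟨Function.update_of_ne hj _ _, Function.update_of_ne hj _ _⟩
    have hleg : S₁.leg i = q := Function.update_self _ _ _
    have hheight : S₁.height i = d' := Function.update_self _ _ _
    have hmove : S.Move S₁ := by
      refine ⟨i, hS₁, fun j hj hl => ?_, fun j hj _ => hheight ▸ hlt j⟩
      by_cases hjT : j ∈ T
      · refine lt_of_le_of_ne (hmin j hjT) fun he => hj ?_
        exact (S.injective (Prod.ext hl.symm he)).symm
      · exact hdown i hi j (hl.trans (hp i hi)) hjT
    obtain ⟨S', h1, h2, h3⟩ := ih S₁ (T.erase i) (by rw [Finset.card_erase_of_mem hi]; omega)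
      (fun j hj => by rw [(hS₁ j (Finset.ne_of_mem_erase hj)).1]
                      exact hp j (Finset.mem_of_mem_erase hj))
      (fun j hj l hl hlT => by
        have hli : l ≠ i := by rintro rfl; exact hpq (hl.symm.trans hleg)
        rw [(hS₁ l hli).1] at hl
        rw [(hS₁ j (Finset.ne_of_mem_erase hj)).2, (hS₁ l hli).2]
        exact hdown j (Finset.mem_of_mem_erase hj) l hl
          fun hl' => hlT (Finset.mem_erase.2 ⟨hli, hl'⟩))
    refine ⟨S', Relation.ReflTransGen.head hmove h1, fun j hj => ?_, fun j hj => ?_⟩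
    · by_cases hji : j = i
      · subst hji
        obtain ⟨h4, h5⟩ := h3 j (by simp)
        rw [h4, h5, hleg, hheight]
        exact ⟨rfl, hd'δ⟩
      · exact h2 j (Finset.mem_erase.2 ⟨hji, hj⟩)
    · have hji : j ≠ i := by rintro rfl; exact hj hi
      obtain ⟨h4, h5⟩ := h3 j fun hj' => hj (Finset.mem_of_mem_erase hj')
      rw [h4, h5]
      exact hS₁ j hji

/-- Particles stacked on one leg can be sorted with the help of two free legs. -/
theorem LegState.exists_sorted (S : LegState k) (hS : ∀ i, S.leg i = 0) :
    ∃ S' : LegState k, Relation.ReflTransGen LegState.Move S S' ∧ (∀ i, S'.leg i = 0) ∧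
      StrictMono S'.height := by
  classical
  -- Invariant: the `n` largest labels are in order at the top of the stack, above all smaller
  -- labels.
  suffices key : ∀ n ≤ k, ∃ S' : LegState k, Relation.ReflTransGen LegState.Move S S' ∧
      (∀ i, S'.leg i = 0) ∧
      ∀ i j : Fin k, i < j → k - n ≤ (j : ℕ) → S'.height i < S'.height j by
    obtain ⟨S', h1, h2, h3⟩ := key k le_rfl
    exact ⟨S', h1, h2, fun i j hij => h3 i j hij (by omega)⟩
  intro n
  induction n with
  | zero => exact fun _ => ⟨S, .refl, hS, fun i j _ hj => absurd j.2 (by omega)⟩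
  | succ n ih =>
    intro hn
    obtain ⟨S₀, hr₀, hl₀, hs₀⟩ := ih (by omega)
    let a : Fin k := ⟨k - (n + 1), by omega⟩
    have hsort : ∀ i j : Fin k, i < j → a < j → S₀.height i < S₀.height j := fun i j hij haj =>
      hs₀ i j hij (by have : k - (n + 1) < (j : ℕ) := haj; omega)
    have hinj₀ : ∀ i j, S₀.height i = S₀.height j → i = j := fun i j he =>
      S₀.injective (Prod.ext ((hl₀ i).trans (hl₀ j).symm) he)
    -- The next label `a` must be placed just under the sorted top. Everything below `a` is first
    -- parked on leg `1`, and `a` then goes alone to leg `2`.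
    let T₁ := Finset.univ.filter fun i => S₀.height i < S₀.height a
    have hT₁ : ∀ i, i ∈ T₁ ↔ S₀.height i < S₀.height a := fun i => by simp [T₁]
    obtain ⟨S₁, hr₁, hin₁, hout₁⟩ := LegState.exists_transfer (p := 0) (q := 1) (by decide)
      one_pos _ S₀ T₁ rfl (fun i _ => hl₀ i) (fun i hi j _ hj =>
        ((hT₁ i).1 hi).trans_le (not_lt.1 fun h => hj ((hT₁ j).2 h)))
    have haT₁ : a ∉ T₁ := fun h => lt_irrefl _ ((hT₁ a).1 h)
    obtain ⟨S₂, hr₂, hin₂, hout₂⟩ := LegState.exists_transfer (p := 0) (q := 2) (by decide)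
      one_pos _ S₁ {a} rfl (fun i hi => by
        rw [Finset.mem_singleton.1 hi, (hout₁ a haT₁).1, hl₀]) (fun i hi j hj hja => by
        rw [Finset.mem_singleton.1 hi, (hout₁ a haT₁).2]
        rw [Finset.mem_singleton] at hja
        have hjT : j ∉ T₁ := fun h => by rw [(hin₁ j h).1] at hj; exact absurd hj (by decide)
        rw [(hout₁ j hjT).2]
        exact lt_of_le_of_ne (not_lt.1 fun h => hjT ((hT₁ j).2 h))
          fun he => hja (hinj₀ _ _ he).symm)
    have hlega₂ : S₂.leg a = 2 := (hin₂ a (Finset.mem_singleton_self a)).1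
    have hout₂' : ∀ j, j ≠ a → S₂.leg j = S₁.leg j ∧ S₂.height j = S₁.height j := fun j hj =>
      hout₂ j (by simpa using hj)
    have hfro₁ : ∀ j, a < j → j ∉ T₁ := fun j hj h =>
      lt_asymm (hsort a j hj hj) ((hT₁ j).1 h)
    -- The smaller labels that were above `a` follow to leg `1`, leaving only the sorted top on leg
    -- `0`.
    let T₃ := Finset.univ.filter fun i => S₂.leg i = 0 ∧ i < a
    have hT₃ : ∀ i, i ∈ T₃ ↔ S₂.leg i = 0 ∧ i < a := fun i => by simp [T₃]
    obtain ⟨S₃, hr₃, hin₃, hout₃⟩ := LegState.exists_transfer (p := 0) (q := 1) (by decide)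
      one_pos _ S₂ T₃ rfl (fun i hi => ((hT₃ i).1 hi).1) (fun i hi j hj hjT => by
        obtain ⟨hi0, hia⟩ := (hT₃ i).1 hi
        have hja : a < j := by
          rcases lt_trichotomy j a with h | h | h
          · exact absurd ((hT₃ j).2 ⟨hj, h⟩) hjT
          · rw [h, hlega₂] at hj; exact absurd hj (by decide)
          · exact h
        rw [(hout₂' i hia.ne).1] at hi0
        have hiT : i ∉ T₁ := fun h => by rw [(hin₁ i h).1] at hi0; exact absurd hi0 (by decide)
        rw [(hout₂' i hia.ne).2, (hout₂' j hja.ne').2, (hout₁ i hiT).2,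
          (hout₁ j (hfro₁ j hja)).2]
        exact hsort i j (hia.trans hja) hja)
    have hlow₃ : ∀ i, i < a → S₃.leg i = 1 := by
      intro i hi
      by_cases hiT : i ∈ T₃
      · exact (hin₃ i hiT).1
      · rw [(hout₃ i hiT).1]
        have h2 : S₂.leg i ≠ 0 := fun h => hiT ((hT₃ i).2 ⟨h, hi⟩)
        rw [(hout₂' i hi.ne).1] at h2 ⊢
        by_cases hi1 : i ∈ T₁
        · exact (hin₁ i hi1).1
        · rw [(hout₁ i hi1).1, hl₀] at h2
          exact absurd rfl h2
    have ha₃ : S₃.leg a = 2 := by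
      rw [(hout₃ a fun h => lt_irrefl _ ((hT₃ a).1 h).2).1, hlega₂]
    have hhigh₃ : ∀ j, a < j → S₃.leg j = 0 ∧ S₃.height j = S₀.height j := by
      intro j hj
      obtain ⟨h1, h2⟩ := hout₃ j fun h => lt_asymm hj ((hT₃ j).1 h).2
      rw [h1, h2, (hout₂' j hj.ne').1, (hout₂' j hj.ne').2, (hout₁ j (hfro₁ j hj)).1,
        (hout₁ j (hfro₁ j hj)).2]
      exact ⟨hl₀ j, rfl⟩
    -- With `δ` below all heights, `a` returns beneath the sorted top; afterwards the smaller labels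
    -- return to heights below that of `a`.
    obtain ⟨δ, hδ0, hδ⟩ := exists_pos_lt_of_finite fun j => (S₃.height_mem j).1
    obtain ⟨S₄, hr₄, hin₄, hout₄⟩ := LegState.exists_transfer (p := 2) (q := 0) (by decide)
      hδ0 _ S₃ {a} rfl (fun i hi => by rw [Finset.mem_singleton.1 hi, ha₃])
      (fun i hi j hj hja => by
        rw [Finset.mem_singleton] at hja
        rcases lt_or_gt_of_ne hja with h | h
        · rw [hlow₃ j h] at hj; exact absurd hj (by decide)
        · rw [(hhigh₃ j h).1] at hj; exact absurd hj (by decide))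
    obtain ⟨ha₄, hah₄⟩ := hin₄ a (Finset.mem_singleton_self a)
    have hout₄' : ∀ j, j ≠ a → S₄.leg j = S₃.leg j ∧ S₄.height j = S₃.height j := fun j hj =>
      hout₄ j (by simpa using hj)
    let T₅ := Finset.univ.filter fun i => i < a
    have hT₅ : ∀ i, i ∈ T₅ ↔ i < a := fun i => by simp [T₅]
    obtain ⟨S₅, hr₅, hin₅, hout₅⟩ := LegState.exists_transfer (p := 1) (q := 0) (by decide)
      (S₄.height_mem a).1 _ S₄ T₅ rfl
      (fun i hi => by
        have hia := (hT₅ i).1 hi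
        rw [(hout₄' i hia.ne).1, hlow₃ i hia])
      (fun i hi j hj hjT => by
        rw [hT₅, not_lt] at hjT
        rcases eq_or_lt_of_le hjT with h | h
        · rw [← h, ha₄] at hj; exact absurd hj (by decide)
        · rw [(hout₄' j h.ne').1, (hhigh₃ j h).1] at hj; exact absurd hj (by decide))
    have ha₅ := hout₅ a fun h => lt_irrefl _ ((hT₅ a).1 h)
    have hhigh₅ : ∀ j, a < j → S₅.leg j = 0 ∧ S₅.height j = S₃.height j := by
      intro j hj
      obtain ⟨h1, h2⟩ := hout₅ j fun h => lt_asymm hj ((hT₅ j).1 h)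
      rw [h1, h2, (hout₄' j hj.ne').1, (hout₄' j hj.ne').2]
      exact ⟨(hhigh₃ j hj).1, rfl⟩
    refine ⟨S₅, ((((hr₀.trans hr₁).trans hr₂).trans hr₃).trans hr₄).trans hr₅, fun i => ?_,
      fun i j hij hj => ?_⟩
    · rcases lt_trichotomy i a with h | rfl | h
      · exact (hin₅ i ((hT₅ i).2 h)).1
      · rw [ha₅.1, ha₄]
      · exact (hhigh₅ i h).1
    · have hja : a ≤ j := hj
      have hbelow : ∀ i, i < a → S₅.height i < S₅.height a := fun i hi => by
        rw [ha₅.2]; exact (hin₅ i ((hT₅ i).2 hi)).2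
      rcases eq_or_lt_of_le hja with h | h
      · rw [← h] at hij ⊢
        exact hbelow i hij
      · have haj : S₅.height a < S₅.height j := by
          rw [ha₅.2, (hhigh₅ j h).2]
          exact hah₄.trans (hδ j)
        rcases lt_trichotomy i a with h' | h' | h'
        · exact (hbelow i h').trans haj
        · rw [h']; exact haj
        · rw [(hhigh₅ j h).2, (hhigh₅ i h').2, (hhigh₃ j h).2, (hhigh₃ i h').2]
          exact hsort i j hij h

end Stacks

/-! ### Legs at edge ends, and path-connectedness of configuration spaces. -/

/-- The point at distance `c` from the end `a` of an edge. -/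
noncomputable def legPoint {E Γ : Type*} (Φ : E × I → Γ) (a : E × I) (c : ℝ) : Γ :=
  edge Φ a.1 ((1 - c) * a.2 + c * (1 - a.2))

/-- The open initial segment of the edge end `a`. -/
def openLeg {E Γ : Type*} (Φ : E × I → Γ) (a : E × I) : Set Γ :=
  legPoint Φ a '' Set.Ioo 0 (1 / 4)

theorem legPoint_zero {E Γ : Type*} (Φ : E × I → Γ) (a : E × I) : legPoint Φ a 0 = Φ a := by
  simp [legPoint, IsGraphModel.edge_coe]

theorem legCoord_mem (a : I) {c : ℝ} (hc : c ∈ Set.Icc (0 : ℝ) 1) :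
    (1 - c) * (a : ℝ) + c * (1 - a) ∈ Set.Icc (0 : ℝ) 1 :=
  convex_Icc (0 : ℝ) 1 a.2 ⟨by linarith [a.2.2], by linarith [a.2.1]⟩ (by linarith [hc.2]) hc.1
    (by ring)

namespace IsGraphModel

variable {E Γ : Type*} [TopologicalSpace E] [DiscreteTopology E] [Finite E]
  [TopologicalSpace Γ] {Φ : E × I → Γ} (h : IsGraphModel Φ) {k : ℕ}

include h

theorem continuous_legPoint (a : E × I) : Continuous (legPoint Φ a) :=
  h.continuous_edge.comp (continuous_const.prodMk (by fun_prop))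

/-- Positivity of `c` makes the point interior, hence with unique coordinates, and the bound `1 / 4`
determines the end from which it is measured. Allowing `d = 0` includes the comparison with base
points of legs. -/
theorem legPoint_injective {a b : E × I} (ha : a.2 = 0 ∨ a.2 = 1) (hb : b.2 = 0 ∨ b.2 = 1)
    {c d : ℝ} (hc : c ∈ Set.Ioc (0 : ℝ) (1 / 4)) (hd : d ∈ Set.Icc (0 : ℝ) (1 / 4))
    (heq : legPoint Φ a c = legPoint Φ b d) : a = b ∧ c = d := by
  obtain ⟨e, τ⟩ := a
  obtain ⟨e', τ'⟩ := b
  obtain ⟨hc0, hc1⟩ := hc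
  obtain ⟨hd0, hd1⟩ := hd
  have hmc := legCoord_mem τ (c := c) ⟨hc0.le, by linarith⟩
  have hmd := legCoord_mem τ' (c := d) ⟨hd0, by linarith⟩
  rw [legPoint, legPoint, edge_of_mem Φ _ hmc, edge_of_mem Φ _ hmd] at heq
  simp only at ha hb
  have h0 : 0 < (1 - c) * (τ : ℝ) + c * (1 - τ) := by
    rcases ha with rfl | rfl <;> norm_num <;> linarith
  have h1 : (1 - c) * (τ : ℝ) + c * (1 - τ) < 1 := by
    rcases ha with rfl | rfl <;> norm_num <;> linarith
  obtain ⟨he, hx⟩ := Prod.mk.inj (h.eq_of_interior _ _ _ h0 h1 heq.symm)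
  have hx' := congrArg Subtype.val hx
  simp only at hx'
  subst he
  rcases ha with rfl | rfl <;> rcases hb with rfl | rfl <;> norm_num at hx' ⊢ <;> linarith

/-- Nothing is glued to interior points of edges, so such a set is saturated for the quotient map
`Φ`. -/
theorem isOpen_image_of_interior [T2Space Γ] {O : Set (E × I)} (hO : IsOpen O)
    (hint : ∀ b ∈ O, 0 < b.2 ∧ b.2 < 1) : IsOpen (Φ '' O) := by
  rw [← h.isQuotientMap.isOpen_preimage]
  convert hO
  refine Set.Subset.antisymm ?_ (Set.subset_preimage_image _ _)
  rintro b ⟨⟨e, c⟩, ha, hab⟩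
  rw [h.eq_of_interior e c b (hint _ ha).1 (hint _ ha).2 hab.symm]
  exact ha

/-- Open subintervals of legs are open. -/
theorem isOpen_legPoint_image [T2Space Γ] {a : E × I} (ha : a.2 = 0 ∨ a.2 = 1) {J : Set ℝ}
    (hJ : IsOpen J) (hsub : J ⊆ Set.Ioo 0 (1 / 4)) : IsOpen (legPoint Φ a '' J) := by
  have hset : legPoint Φ a '' J =
      Φ '' {b | b.1 = a.1 ∧ |(b.2 : ℝ) - a.2| ∈ J} := by
    ext p
    constructor
    · rintro ⟨c, hc, rfl⟩
      have hc' := hsub hc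
      have hm := legCoord_mem a.2 (c := c) ⟨hc'.1.le, by linarith [hc'.2]⟩
      refine ⟨(a.1, ⟨_, hm⟩), ⟨rfl, ?_⟩, (edge_of_mem Φ _ hm).symm⟩
      have : |(1 - c) * (a.2 : ℝ) + c * (1 - a.2) - a.2| = c := by
        rcases ha with ha | ha <;> rw [ha]
        · simp [abs_of_pos hc'.1]
        · simp [abs_of_pos hc'.1]
      simpa only [this] using hc
    · rintro ⟨⟨e, x⟩, ⟨rfl, hx⟩, rfl⟩
      refine ⟨_, hx, ?_⟩
      have : (1 - |(x : ℝ) - a.2|) * (a.2 : ℝ) + |(x : ℝ) - a.2| * (1 - a.2) = x := by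
        rcases ha with ha | ha <;> rw [ha]
        · simp [abs_of_nonneg x.2.1]
        · simp only [Set.Icc.coe_one]
          rw [abs_of_nonpos (by linarith [x.2.2])]; ring
      rw [legPoint, this, edge_coe]
  rw [hset]
  refine h.isOpen_image_of_interior ?_ ?_
  · refine ((isOpen_discrete {a.1}).preimage continuous_fst).inter (hJ.preimage ?_)
    fun_prop
  · rintro ⟨e, x⟩ ⟨-, hx⟩
    have hx' := hsub hx
    simp only at hx' ⊢
    constructor
    · refine unitInterval.pos_iff_ne_zero.2 ?_
      rintro rfl
      rcases ha with ha | ha <;> rw [ha] at hx' <;> norm_num at hx'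
    · refine unitInterval.lt_one_iff_ne_one.2 ?_
      rintro rfl
      rcases ha with ha | ha <;> rw [ha] at hx' <;> norm_num at hx'

/-- A set closed under joining by paths is a union of whole edges, hence closed. This applies to a
path component and to its complement. -/
theorem pathConnectedSpace [T2Space Γ] [ConnectedSpace Γ] : PathConnectedSpace Γ := by
  obtain ⟨p⟩ := (inferInstance : Nonempty Γ)
  have hedge : ∀ e (c d : I), Joined (Φ (e, c)) (Φ (e, d)) := by
    intro e c d
    have hc : Continuous fun c : I => Φ (e, c) := h.continuous.comp (by fun_prop)
    have : PathConnectedSpace I := isPathConnected_iff_pathConnectedSpace.1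
      ((convex_Icc (0 : ℝ) 1).isPathConnected (Set.nonempty_Icc.2 zero_le_one))
    exact (PathConnectedSpace.joined c d).map hc
  have hclosed : ∀ A : Set Γ, (∀ p q, p ∈ A → Joined p q → q ∈ A) → IsClosed A := by
    intro A hA
    have : A = Φ '' {b | Φ (b.1, 0) ∈ A} := by
      ext q
      constructor
      · intro hq
        refine ⟨h.coord q, hA q _ hq ?_, h.apply_coord q⟩
        conv_lhs => rw [← h.apply_coord q]
        exact hedge _ _ _
      · rintro ⟨⟨e, c⟩, hb, rfl⟩
        exact hA _ _ hb (hedge _ _ _)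
    rw [this]
    exact h.isClosedMap _ ((isClosed_discrete {e | Φ (e, 0) ∈ A}).preimage continuous_fst)
  have hcl : IsClopen (pathComponent p) := by
    refine ⟨hclosed _ fun q r hq hr => Joined.trans hq hr, ?_⟩
    rw [← isClosed_compl_iff]
    exact hclosed _ fun q r hq hr hr' => hq (Joined.trans hr' hr.symm)
  have huniv := hcl.eq_univ ⟨p, mem_pathComponent_self p⟩
  rw [pathConnectedSpace_iff_eq]
  exact ⟨p, huniv⟩

theorem infinite [Nonempty E] : Infinite Γ := by
  obtain ⟨e⟩ := ‹Nonempty E›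
  have hinj : Set.InjOn (fun c : I => Φ (e, c)) (Set.Ioo 0 1) := fun c hc d hd heq =>
    (Prod.mk.inj (h.eq_of_interior e d (e, c) hd.1 hd.2 heq)).2
  exact Set.infinite_univ_iff.1
    (((Set.Ioo_infinite zero_lt_one).image hinj).mono (Set.subset_univ _))

theorem nonempty_orderedConf [Nonempty E] (k : ℕ) : Nonempty (OrderedConf k Γ) := by
  have := h.infinite
  exact ⟨⟨fun i => Infinite.natEmbedding Γ i, fun i j hij =>
    Fin.ext ((Infinite.natEmbedding Γ).injective hij)⟩⟩

-- Lets a particle step into a leg from either of its ends without meeting the finitely many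
-- occupied parameters `T`.
omit h [TopologicalSpace E] [DiscreteTopology E] [Finite E] [TopologicalSpace Γ] in
theorem exists_near_avoiding {T : Set ℝ} (hT : T.Finite) {c : ℝ} (hc : c = 0 ∨ c = 1 / 4)
    (hcT : c ∉ T) :
    ∃ δ ∈ Set.Ioo (0 : ℝ) (1 / 4), ∀ d ∈ Set.uIcc c δ, d ≠ c → d ∈ Set.Ioo (0 : ℝ) (1 / 4) \ T := by
  obtain ⟨ε, hε, hball⟩ := Metric.isOpen_iff.1 hT.isClosed.isOpen_compl c hcT
  have hmin : 0 < min (ε / 2) (1 / 8) := by positivity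
  have hl := min_le_left (ε / 2) (1 / 8)
  have hr := min_le_right (ε / 2) (1 / 8)
  set η := min (ε / 2) (1 / 8)
  rcases hc with rfl | rfl
  · refine ⟨η, ⟨hmin, by linarith⟩, fun d hd hne => ?_⟩
    rw [Set.uIcc_of_le hmin.le] at hd
    refine ⟨⟨lt_of_le_of_ne hd.1 (Ne.symm hne), by linarith [hd.2]⟩, hball ?_⟩
    rw [Metric.mem_ball, Real.dist_eq, abs_of_nonneg (by linarith [hd.1])]
    linarith [hd.2]
  · refine ⟨1 / 4 - η, ⟨by linarith, by linarith⟩, fun d hd hne => ?_⟩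
    rw [Set.uIcc_of_ge (by linarith)] at hd
    refine ⟨⟨by linarith [hd.1], lt_of_le_of_ne hd.2 hne⟩, hball ?_⟩
    rw [Metric.mem_ball, Real.dist_eq, abs_of_nonpos (by linarith [hd.2])]
    linarith [hd.1]

/-- If not all particles lie in a given leg, some particle can move there. -/
theorem exists_move_to_leg [T2Space Γ] [PathConnectedSpace Γ] {a : E × I}
    (ha : a.2 = 0 ∨ a.2 = 1) (x : OrderedConf k Γ) {i : Fin k} (hi : x.1 i ∉ openLeg Φ a) :
    ∃ (y : OrderedConf k Γ) (j : Fin k), Joined x y ∧ x.1 j ∉ openLeg Φ a ∧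
      y.1 j ∈ openLeg Φ a ∧ ∀ l ≠ j, y.1 l = x.1 l := by
  have hLopen : IsOpen (openLeg Φ a) := h.isOpen_legPoint_image ha isOpen_Ioo subset_rfl
  have hleg := h.continuous_legPoint a
  let γ : Path (x.1 i) (Φ a) := (PathConnectedSpace.joined _ _).somePath
  let C : Set Γ := x.1 '' {l | x.1 l ∉ openLeg Φ a}
  let L : Set Γ := legPoint Φ a '' Set.Icc 0 (1 / 4)
  have hCc : IsClosed C := ((Set.toFinite _).image _).isClosed
  have hLc : IsClosed L := (isCompact_Icc.image hleg).isClosed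
  have hsubL : openLeg Φ a ⊆ L := Set.image_mono Set.Ioo_subset_Icc_self
  -- Minimizing the time between leaving an outside particle and reaching the closed leg selects the
  -- particle to move: between these times the path meets no other particle.
  let K : Set (I × I) := {s | γ s.1 ∈ C ∧ γ s.2 ∈ L ∧ s.1 ≤ s.2}
  have hK : IsCompact K := by
    refine IsClosed.isCompact ?_
    refine IsClosed.inter (hCc.preimage (by fun_prop)) (IsClosed.inter
      (hLc.preimage (by fun_prop))
      (isClosed_le continuous_fst continuous_snd : IsClosed {s : I × I | s.1 ≤ s.2}))
  have hKne : K.Nonempty := by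
    refine ⟨(0, 1), ?_, ?_, zero_le_one⟩
    · simp only [Path.source]; exact ⟨i, hi, rfl⟩
    · simp only [Path.target]; exact ⟨0, by norm_num, legPoint_zero Φ a⟩
  obtain ⟨⟨s₀, s₁⟩, ⟨⟨j, hj, hj0⟩, ⟨c, hc, hc1⟩, hle⟩, hmin⟩ := hK.exists_isMinOn hKne
    (f := fun s : I × I => (s.2 : ℝ) - s.1) (by fun_prop)
  simp only at hj0 hc1 hle
  have hmin' : ∀ s s' : I, γ s ∈ C → γ s' ∈ L → s ≤ s' → (s₁ : ℝ) - s₀ ≤ (s' : ℝ) - s :=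
    fun s s' h1 h2 h3 => hmin (show (s, s') ∈ K from ⟨h1, h2, h3⟩)
  have hend : γ s₁ ∈ L := ⟨c, hc, hc1⟩
  have hstart : γ s₀ ∈ C := ⟨j, hj, hj0⟩
  have hC : ∀ s, s₀ < s → s ≤ s₁ → γ s ∉ C := by
    intro s h1 h2 h3
    have := hmin' s s₁ h3 hend h2
    have h1' : (s₀ : ℝ) < s := h1
    linarith
  have hL : ∀ s, s₀ ≤ s → s < s₁ → γ s ∉ L := by
    intro s h1 h2 h3
    have := hmin' s₀ s hstart h3 h1
    have h2' : (s : ℝ) < s₁ := h2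
    linarith
  -- The leg is first met at one of its ends. The gap may be zero, in which case the particle
  -- already sits at an end.
  have hend' : γ s₁ ∉ openLeg Φ a := by
    rcases eq_or_lt_of_le hle with h1 | h1
    · rw [← h1, ← hj0]; exact hj
    · intro h2
      have hopen : IsOpen (γ ⁻¹' openLeg Φ a) := hLopen.preimage γ.continuous
      obtain ⟨l, hl, hsub⟩ := exists_Ioc_subset_of_mem_nhds (hopen.mem_nhds h2) ⟨s₀, h1⟩
      obtain ⟨s, hs1, hs2⟩ := exists_between (max_lt hl h1)
      exact hL s ((le_max_right _ _).trans hs1.le) hs2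
        (hsubL (hsub ⟨(le_max_left _ _).trans_lt hs1, hs2.le⟩))
  have hcend : c = 0 ∨ c = 1 / 4 := by
    by_contra! hcon
    exact hend' ⟨c, ⟨lt_of_le_of_ne hc.1 (Ne.symm hcon.1), lt_of_le_of_ne hc.2 hcon.2⟩, hc1⟩
  let T : Set ℝ := {d | d ∈ Set.Ioo (0 : ℝ) (1 / 4) ∧ legPoint Φ a d ∈ Set.range x.1}
  have hTfin : T.Finite := by
    refine Set.Finite.of_finite_image (f := legPoint Φ a)
      ((Set.finite_range x.1).subset ?_) ?_
    · rintro _ ⟨d, hd, rfl⟩; exact hd.2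
    · intro d hd d' hd' heq
      exact (h.legPoint_injective ha ha ⟨hd.1.1, hd.1.2.le⟩ ⟨hd'.1.1.le, hd'.1.2.le⟩ heq).2
  obtain ⟨δ, hδ, hδT⟩ := exists_near_avoiding hTfin hcend fun hcT => by
    rcases hcend with h1 | h1
    · exact hcT.1.1.ne' h1
    · exact hcT.1.2.ne h1
  have hnotC : ∀ l ≠ j, γ s₁ ≠ x.1 l := by
    intro l hl heq
    have hlC : x.1 l ∉ openLeg Φ a := by rw [← heq]; exact hend'
    rcases eq_or_lt_of_le hle with h1 | h1
    · rw [← h1, ← hj0] at heq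
      exact hl (x.2 heq).symm
    · exact hC s₁ h1 le_rfl ⟨l, hlC, heq.symm⟩
  have hq : ∀ l ≠ j, legPoint Φ a δ ≠ x.1 l := by
    intro l _ heq
    have hne : δ ≠ c := by
      rintro rfl
      rcases hcend with h1 | h1
      · exact hδ.1.ne' h1
      · exact hδ.2.ne h1
    exact (hδT δ Set.right_mem_uIcc hne).2 ⟨hδ, l, heq.symm⟩
  let y : OrderedConf k Γ := ⟨Function.update x.1 j (legPoint Φ a δ), by
    intro l m hlm
    by_cases hlj : l = j <;> by_cases hmj : m = j
    · rw [hlj, hmj]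
    · subst hlj
      rw [Function.update_self, Function.update_of_ne hmj] at hlm
      exact absurd hlm (hq m hmj)
    · subst hmj
      rw [Function.update_self, Function.update_of_ne hlj] at hlm
      exact absurd hlm.symm (hq l hlj)
    · rw [Function.update_of_ne hlj, Function.update_of_ne hmj] at hlm
      exact x.2 hlm⟩
  have hyj : y.1 j = legPoint Φ a δ := Function.update_self _ _ _
  have hyl : ∀ l ≠ j, y.1 l = x.1 l := fun l hl => Function.update_of_ne hl _ _
  refine ⟨y, j, joined_of_joinedIn j hyl ?_, hj, hyj ▸ ⟨δ, hδ, rfl⟩, hyl⟩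
  have j1 : JoinedIn {p | ∀ l ≠ j, p ≠ x.1 l} (x.1 j) (γ s₁) := by
    have hpc : IsPathConnected (γ '' Set.Icc s₀ s₁) := by
      have hIcc : IsPathConnected (Set.Icc s₀ s₁) := by
        rw [isPathConnected_iff_pathConnectedSpace]
        have : IsPathConnected (Set.Icc (s₀ : ℝ) s₁) :=
          (convex_Icc _ _).isPathConnected (Set.nonempty_Icc.2 hle)
        have hproj := this.image (continuous_projIcc (h := zero_le_one (α := ℝ)))
        rw [← isPathConnected_iff_pathConnectedSpace]
        convert hproj using 1
        ext s
        constructor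
        · intro hs
          exact ⟨s, hs, Set.projIcc_val _ s⟩
        · rintro ⟨r, hr, rfl⟩
          have hr' : r ∈ Set.Icc (0 : ℝ) 1 := ⟨s₀.2.1.trans hr.1, hr.2.trans s₁.2.2⟩
          rw [Set.projIcc_of_mem _ hr']
          exact hr
      exact hIcc.image γ.continuous
    have := hpc.joinedIn (γ s₀) ⟨s₀, ⟨le_rfl, hle⟩, rfl⟩ (γ s₁) ⟨s₁, ⟨hle, le_rfl⟩, rfl⟩
    rw [← hj0] at this
    refine this.mono ?_
    rintro _ ⟨s, ⟨hs0, hs1⟩, rfl⟩ l hl heq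
    rcases eq_or_lt_of_le hs1 with h1 | h1
    · subst h1; exact hnotC l hl heq
    · have hnL := hL s hs0 h1
      rcases eq_or_lt_of_le hs0 with h2 | h2
      · rw [← h2, ← hj0] at heq
        exact hl (x.2 heq).symm
      · exact hC s h2 hs1 ⟨l, fun h3 => hnL (by rw [heq]; exact hsubL h3), heq.symm⟩
  -- From the end of the leg the particle moves a short unoccupied distance inside.
  have j2 : JoinedIn {p | ∀ l ≠ j, p ≠ x.1 l} (γ s₁) (legPoint Φ a δ) := by
    have hpc : IsPathConnected (legPoint Φ a '' Set.uIcc c δ) :=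
      ((convex_uIcc c δ).isPathConnected Set.nonempty_uIcc).image hleg
    rw [← hc1]
    refine (hpc.joinedIn _ ⟨c, Set.left_mem_uIcc, rfl⟩ _ ⟨δ, Set.right_mem_uIcc, rfl⟩).mono ?_
    rintro _ ⟨d, hd, rfl⟩ l hl heq
    by_cases hdc : d = c
    · rw [hdc, hc1] at heq
      exact hnotC l hl heq
    · obtain ⟨h1, h2⟩ := hδT d hd hdc
      exact h2 ⟨h1, l, heq.symm⟩
  rw [hyj]
  exact j1.trans j2

theorem exists_joined_mem_leg [T2Space Γ] [PathConnectedSpace Γ] {a : E × I}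
    (ha : a.2 = 0 ∨ a.2 = 1) (x : OrderedConf k Γ) :
    ∃ y : OrderedConf k Γ, Joined x y ∧ ∀ i, y.1 i ∈ openLeg Φ a := by
  induction hn : {i | x.1 i ∉ openLeg Φ a}.ncard using Nat.strong_induction_on generalizing x with
  | _ n ih =>
    by_cases hall : ∀ i, x.1 i ∈ openLeg Φ a
    · exact ⟨x, Joined.refl x, hall⟩
    · push Not at hall
      obtain ⟨i, hi⟩ := hall
      obtain ⟨y, j, hxy, hj, hyj, hy⟩ := h.exists_move_to_leg ha x hi
      have hlt : {i | y.1 i ∉ openLeg Φ a}.ncard < n := by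
        rw [← hn]
        refine Set.ncard_lt_ncard ⟨fun l hl => ?_, fun hsub => hsub hj hyj⟩ (Set.toFinite _)
        have hlj : l ≠ j := by rintro rfl; exact hl hyj
        change x.1 l ∉ _
        rw [← hy l hlj]; exact hl
      obtain ⟨z, hyz, hz⟩ := ih _ hlt y rfl
      exact ⟨z, hxy.trans hyz, hz⟩

/-- The configuration described by stacks of particles on three legs at a branch point. -/
noncomputable def legConf {a : Fin 3 → E × I} (ha : Function.Injective a)
    (hend : ∀ n, (a n).2 = 0 ∨ (a n).2 = 1) (S : LegState k) : OrderedConf k Γ :=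
  ⟨fun i => legPoint Φ (a (S.leg i)) (S.height i), fun i j hij => by
    obtain ⟨h1, h2⟩ := h.legPoint_injective (hend _) (hend _)
      ⟨(S.height_mem i).1, (S.height_mem i).2.le⟩ ⟨(S.height_mem j).1.le, (S.height_mem j).2.le⟩ hij
    exact S.injective (Prod.ext (ha h1) h2)⟩

/-- The lowest particle of a stack slides down to the common point `v` and up into the other leg,
staying below all particles there. -/
theorem joined_of_move {a : Fin 3 → E × I} (ha : Function.Injective a)
    (hend : ∀ n, (a n).2 = 0 ∨ (a n).2 = 1) {v : Γ} (hv : ∀ n, Φ (a n) = v) {S S' : LegState k}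
    (hS : S.Move S') : Joined (h.legConf ha hend S) (h.legConf ha hend S') := by
  obtain ⟨i, h1, h2, h3⟩ := hS
  refine joined_of_joinedIn i (fun j hj => ?_) ?_
  · change legPoint Φ (a (S'.leg j)) (S'.height j) = legPoint Φ (a (S.leg j)) (S.height j)
    rw [(h1 j hj).1, (h1 j hj).2]
  · have key : ∀ (n : Fin 3) (c : ℝ), c ∈ Set.Ioo (0 : ℝ) (1 / 4) →
        (∀ j ≠ i, S.leg j = n → c < S.height j) →
        JoinedIn {p | ∀ j ≠ i, p ≠ (h.legConf ha hend S).1 j} v (legPoint Φ (a n) c) := by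
      intro n c hc hlow
      have hpc : IsPathConnected (legPoint Φ (a n) '' Set.Icc 0 c) :=
        ((convex_Icc 0 c).isPathConnected (Set.nonempty_Icc.2 hc.1.le)).image
          (h.continuous_legPoint _)
      have hJ := hpc.joinedIn _ ⟨0, ⟨le_rfl, hc.1.le⟩, rfl⟩ _ ⟨c, ⟨hc.1.le, le_rfl⟩, rfl⟩
      rw [legPoint_zero, hv n] at hJ
      refine hJ.mono ?_
      rintro _ ⟨d, hd, rfl⟩ j hj heq
      obtain ⟨e1, e2⟩ := h.legPoint_injective (hend _) (hend _)
        ⟨(S.height_mem j).1, (S.height_mem j).2.le⟩ ⟨hd.1, hd.2.trans hc.2.le⟩ heq.symm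
      have := hlow j hj (ha e1)
      linarith [hd.2]
    exact (key _ _ (S.height_mem i) h2).symm.trans (key _ _ (S'.height_mem i) h3)

/-- Configuration spaces of graphs with a branch point are path-connected. -/
theorem joined_orderedConf [T2Space Γ] [PathConnectedSpace Γ] {v : Γ}
    (hv : 3 ≤ (Φ ⁻¹' {v}).encard) (x y : OrderedConf k Γ) : Joined x y := by
  obtain ⟨t, ht, htc⟩ := Set.exists_subset_encard_eq hv
  obtain ⟨b₀, b₁, b₂, h01, h02, h12, rfl⟩ := Set.encard_eq_three.1 htc
  let a : Fin 3 → E × I := ![b₀, b₁, b₂]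
  have ha : Function.Injective a := by
    intro n m hnm
    fin_cases n <;> fin_cases m <;> simp_all [a]
  have hav : ∀ n, Φ (a n) = v := by
    intro n
    apply ht
    fin_cases n <;> simp [a]
  have hend : ∀ n, (a n).2 = 0 ∨ (a n).2 = 1 := by
    intro n
    obtain ⟨m, hm⟩ : ∃ m, m ≠ n := exists_ne n
    exact h.endpoint_of_ne ((hav n).trans (hav m).symm) (ha.ne hm.symm)
  -- Normal form: all particles on leg `0`, in the order of their labels. Two such configurations
  -- are joined by straight lines.
  have key : ∀ x : OrderedConf k Γ, ∃ (c : Fin k → ℝ) (z : OrderedConf k Γ), StrictMono c ∧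
      (∀ i, c i ∈ Set.Ioo (0 : ℝ) (1 / 4)) ∧ (∀ i, z.1 i = legPoint Φ (a 0) (c i)) ∧
      Joined x z := by
    intro x
    obtain ⟨y, hxy, hy⟩ := h.exists_joined_mem_leg (hend 0) x
    choose c hc hcy using hy
    let S : LegState k :=
      { leg := fun _ => 0
        height := c
        height_mem := hc
        injective := fun i j hij => y.2 (by
          rw [← hcy i, ← hcy j, (Prod.mk.inj hij).2]) }
    have hSy : h.legConf ha hend S = y := Subtype.ext (funext hcy)
    obtain ⟨S', hSS', hl, hmono⟩ := S.exists_sorted fun _ => rfl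
    have hJ : Joined (h.legConf ha hend S) (h.legConf ha hend S') := by
      clear hl hmono
      induction hSS' with
      | refl => exact Joined.refl _
      | tail _ hm ih => exact ih.trans (h.joined_of_move ha hend hav hm)
    refine ⟨S'.height, h.legConf ha hend S', hmono, S'.height_mem, fun i => ?_,
      hxy.trans (hSy ▸ hJ)⟩
    change legPoint Φ (a (S'.leg i)) _ = _
    rw [hl]
  obtain ⟨c, z, hc, hcm, hz, hxz⟩ := key x
  obtain ⟨d, w, hd, hdm, hw, hyw⟩ := key y
  refine (hxz.trans ?_).trans hyw.symm
  exact joined_of_strictMono (h.continuous_legPoint (a 0)) (convex_Ioo _ _)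
    (fun c hc d hd heq => (h.legPoint_injective (hend 0) (hend 0) ⟨hc.1, hc.2.le⟩
      ⟨hd.1.le, hd.2.le⟩ heq).2) hc hd hcm hdm hz hw

end IsGraphModel

/-! ### Bounds by the number of branch points, and graphs without branch points. -/

namespace IsGraphModel

variable {E Γ : Type*} [TopologicalSpace E] [DiscreteTopology E] [Finite E]
  [TopologicalSpace Γ] {Φ : E × I → Γ} (h : IsGraphModel Φ) {k : ℕ}

include h

theorem exists_thresholds (n : ℕ) :
    ∃ t : Fin n → ℝ, StrictMono t ∧ ∀ l, 0 < t l ∧ t l ≤ 1 := by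
  refine ⟨fun l => ((l : ℕ) + 1) / n, fun l m hlm => ?_, fun l => ?_⟩
  · have hn : (0 : ℝ) < n := by exact_mod_cast (Nat.zero_le _).trans_lt l.2
    have : (l : ℝ) < m := by exact_mod_cast hlm
    simp only
    gcongr
  · have hn : (0 : ℝ) < n := by exact_mod_cast (Nat.zero_le _).trans_lt l.2
    refine ⟨by positivity, ?_⟩
    rw [div_le_one hn]
    exact_mod_cast l.2

theorem TC_orderedConf_le [T2Space Γ] [PathConnectedSpace (OrderedConf k Γ)] {r : ℕ}
    (hr : 0 < r) :
    TC r (OrderedConf k Γ) ≤ ((r * (regularSet Φ)ᶜ.ncard : ℕ) : ℕ∞) := by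
  obtain ⟨t, ht, ht01⟩ := h.exists_thresholds (r * (regularSet Φ)ᶜ.ncard + 1)
  refine TC_le_of_multicover hr (fun l => h.decidedSet k (t l)) (fun l => h.isOpen_decidedSet _)
    (fun l => ?_) fun x => h.ncard_notMem_decidedSet_le ht x
  obtain ⟨H, hH, h0, h1, -⟩ := h.exists_deformation k (ht01 l).1 (ht01 l).2
  exact isCategorical_of_homotopy H hH h0 h1

theorem TC_unorderedConf_le [T2Space Γ] [PathConnectedSpace (UnorderedConf k Γ)] {r : ℕ}
    (hr : 0 < r) :
    TC r (UnorderedConf k Γ) ≤ ((r * (regularSet Φ)ᶜ.ncard : ℕ) : ℕ∞) := by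
  obtain ⟨t, ht, ht01⟩ := h.exists_thresholds (r * (regularSet Φ)ᶜ.ncard + 1)
  refine TC_le_of_multicover hr (fun l => toUnordered '' h.decidedSet k (t l))
    (fun l => isOpenQuotientMap_toUnordered.isOpenMap _ (h.isOpen_decidedSet _))
    (fun l => ?_) fun b => ?_
  · obtain ⟨H, hH, h0, h1, h2⟩ := h.exists_deformation k (ht01 l).1 (ht01 l).2
    exact isCategorical_image_toUnordered (fun _ hx π => relabel_mem_decidedSet π hx) H hH h0 h1 h2
  · obtain ⟨x, rfl⟩ := toUnordered_surjective b
    refine (Set.ncard_le_ncard ?_ (Set.toFinite _)).trans (h.ncard_notMem_decidedSet_le ht x)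
    exact fun l hl hx => hl ⟨x, hx, rfl⟩

/-- An edge not glued to any other edge has a clopen image, so by connectedness it is the only one.
-/
theorem eq_univ_of_edge_saturated [T2Space Γ] [ConnectedSpace Γ] {e : E}
    (he : ∀ a c, Φ a = Φ (e, c) → a.1 = e) : ∀ a : E × I, a.1 = e := by
  have hpre : Φ ⁻¹' (Φ '' {a | a.1 = e}) = {a | a.1 = e} := by
    refine Set.Subset.antisymm ?_ (Set.subset_preimage_image _ _)
    rintro a ⟨⟨_, c⟩, rfl, hb⟩
    exact he a c hb.symm
  have hcl : IsClopen {a : E × I | a.1 = e} := (isClopen_discrete {e}).preimage continuous_fst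
  have hcl' : IsClopen (Φ '' {a | a.1 = e}) :=
    ⟨h.isClosedMap _ hcl.1, by rw [← h.isQuotientMap.isOpen_preimage, hpre]; exact hcl.2⟩
  have huniv := hcl'.eq_univ ⟨Φ (e, 0), _, rfl, rfl⟩
  intro a
  have : a ∈ Φ ⁻¹' (Φ '' {a | a.1 = e}) := by rw [huniv]; trivial
  rwa [hpre] at this

theorem bijective_edge_of_regular [T2Space Γ] [ConnectedSpace Γ] (hreg : regularSet Φ = Set.univ)
    (e : E) : Function.Bijective fun c => Φ (e, c) := by
  have hinj : Function.Injective Φ := fun a b hab =>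
    (hreg ▸ Set.mem_univ (Φ a) : Φ a ∈ regularSet Φ) a b rfl hab.symm
  have hall := h.eq_univ_of_edge_saturated (e := e) fun a c hac => by rw [hinj hac]
  refine ⟨fun c d hcd => (Prod.mk.inj (hinj hcd)).2, fun p => ?_⟩
  obtain ⟨a, rfl⟩ := h.surjective p
  exact ⟨a.2, by rw [← hall a]⟩

theorem nonempty_homeomorph_unitInterval [T2Space Γ] [ConnectedSpace Γ]
    (hreg : regularSet Φ = Set.univ) (e : E) : Nonempty (Γ ≃ₜ I) := by
  have hc : Continuous fun c : I => Φ (e, c) := h.continuous.comp (by fun_prop)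
  exact ⟨(Continuous.homeoOfEquivCompactToT2
    (f := Equiv.ofBijective _ (h.bijective_edge_of_regular hreg e)) hc).symm⟩

/-- On an interval the labels may be permuted freely, so both configurations are sorted by
coordinate and joined by straight lines. -/
theorem joined_toUnordered_of_regular [T2Space Γ] [ConnectedSpace Γ]
    (hreg : regularSet Φ = Set.univ) (e : E) (x y : OrderedConf k Γ) :
    Joined (toUnordered x) (toUnordered y) := by
  have hbij := h.bijective_edge_of_regular hreg e
  have key : ∀ x : OrderedConf k Γ, ∃ (c : Fin k → ℝ) (z : OrderedConf k Γ), StrictMono c ∧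
      (∀ i, c i ∈ Set.Icc (0 : ℝ) 1) ∧ (∀ i, z.1 i = edge Φ e (c i)) ∧
      toUnordered x = toUnordered z := by
    intro x
    choose c hc using fun i => hbij.2 (x.1 i)
    simp only at hc
    have hcinj : Function.Injective fun i => (c i : ℝ) := fun i j hij =>
      x.2 (by rw [← hc i, ← hc j, Subtype.ext hij])
    let π := Tuple.sort fun i => (c i : ℝ)
    refine ⟨fun i => c (π i), x.relabel π,
      (Tuple.monotone_sort fun i => (c i : ℝ)).strictMono_of_injective
        (hcinj.comp π.injective), fun i => (c (π i)).2, fun i => ?_,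
      toUnordered_eq.2 ⟨π, rfl⟩⟩
    rw [edge_coe, hc]; rfl
  obtain ⟨c, z, hc, hcm, hz, hxz⟩ := key x
  obtain ⟨d, w, hd, hdm, hw, hyw⟩ := key y
  rw [hxz, hyw]
  refine Joined.map (joined_of_strictMono (f := edge Φ e)
    (h.continuous_edge.comp (continuous_const.prodMk continuous_id)) (convex_Icc 0 1) ?_ hc hd hcm
      hdm hz hw) continuous_toUnordered
  intro c hc d hd heq
  rw [edge_of_mem Φ e hc, edge_of_mem Φ e hd] at heq
  exact congrArg Subtype.val (hbij.1 heq)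

end IsGraphModel

/-! ### Removal of bivalent points. -/

namespace IsGraphModel

section Circle

variable {E Γ : Type*} [TopologicalSpace E] [DiscreteTopology E] [Finite E]
  [TopologicalSpace Γ] {Φ : E × I → Γ} (h : IsGraphModel Φ)

include h

/-- A connected graph with a bivalent vertex on a loop is a circle. -/
theorem nonempty_homeomorph_circle [T2Space Γ] [ConnectedSpace Γ] {e : E}
    (h01 : Φ (e, 0) = Φ (e, 1)) (hfib : ∀ a, Φ a = Φ (e, 0) → a.1 = e) :
    Nonempty (Γ ≃ₜ Circle) := by
  have hall : ∀ a : E × I, a.1 = e := by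
    refine h.eq_univ_of_edge_saturated fun a c hac => ?_
    by_cases hne : a = (e, c)
    · rw [hne]
    · rcases h.endpoint_of_ne hac.symm (Ne.symm hne) with hc | hc <;> simp only at hc <;> subst hc
      · exact hfib a hac
      · exact hfib a (hac.trans h01.symm)
  have := Fact.mk (zero_lt_one (α := ℝ))
  -- The edge coordinate modulo one respects the gluing and induces the homeomorphism.
  let f : E × I → AddCircle (1 : ℝ) := fun a => ((a.2 : ℝ) : AddCircle (1 : ℝ))
  have hf1 : ((1 : ℝ) : AddCircle (1 : ℝ)) = ((0 : ℝ) : AddCircle (1 : ℝ)) := by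
    simp
  have hends : ∀ c : I, c = 0 ∨ c = 1 → ((c : ℝ) : AddCircle (1 : ℝ)) = ((0 : ℝ) : AddCircle _) := by
    rintro c (rfl | rfl)
    · rfl
    · exact hf1
  have hf : ∀ a b, Φ a = Φ b → f a = f b := by
    intro a b hab
    by_cases hne : a = b
    · rw [hne]
    · exact (hends _ (h.endpoint_of_ne hab hne)).trans
        (hends _ (h.endpoint_of_ne hab.symm (Ne.symm hne))).symm
  have hfc : Continuous f :=
    (AddCircle.continuous_mk' (1 : ℝ)).comp (by fun_prop : Continuous fun a : E × I => (a.2 : ℝ))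
  have hg := h.continuous_comp_surjInv hf hfc
  have hcompact := h.compactSpace
  have hbij : Function.Bijective fun p => f (Function.surjInv h.surjective p) := by
    constructor
    · intro p q hpq
      obtain ⟨⟨e₁, c⟩, rfl⟩ := h.surjective p
      obtain ⟨⟨e₂, d⟩, rfl⟩ := h.surjective q
      simp only [h.comp_surjInv_apply hf] at hpq
      obtain rfl := hall (e₁, c)
      obtain rfl := hall (e₂, d)
      simp only [f] at hpq
      by_cases hc : c = 1 <;> by_cases hd : d = 1
      · rw [hc, hd]
      · subst hc
        have hd' : (d : ℝ) < 1 := unitInterval.lt_one_iff_ne_one.2 hd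
        have : (0 : ℝ) = d := (AddCircle.coe_eq_coe_iff_of_mem_Ico (p := (1 : ℝ)) (a := 0)
          (by norm_num) ⟨d.2.1, by linarith⟩).1 (hf1.symm.trans hpq)
        rw [← h01]
        exact congrArg (fun x => Φ (_, x)) (Subtype.ext this)
      · subst hd
        have hc' : (c : ℝ) < 1 := unitInterval.lt_one_iff_ne_one.2 hc
        have : (c : ℝ) = 0 := (AddCircle.coe_eq_coe_iff_of_mem_Ico (p := (1 : ℝ)) (a := 0)
          ⟨c.2.1, by linarith⟩ (by norm_num)).1 (hpq.trans hf1)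
        rw [← h01]
        exact congrArg (fun x => Φ (_, x)) (Subtype.ext this)
      · have hc' : (c : ℝ) < 1 := unitInterval.lt_one_iff_ne_one.2 hc
        have hd' : (d : ℝ) < 1 := unitInterval.lt_one_iff_ne_one.2 hd
        have := (AddCircle.coe_eq_coe_iff_of_mem_Ico (p := (1 : ℝ)) (a := 0)
          ⟨c.2.1, by linarith⟩ ⟨d.2.1, by linarith⟩).1 hpq
        rw [Subtype.ext this]
    · intro z
      have hz : z ∈ ((↑) : ℝ → AddCircle (1 : ℝ)) '' Set.Icc 0 (0 + 1) := by
        rw [AddCircle.coe_image_Icc_eq]; trivial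
      obtain ⟨c, hc, rfl⟩ := hz
      rw [zero_add] at hc
      exact ⟨Φ (e, ⟨c, hc⟩), h.comp_surjInv_apply hf _⟩
  have hhomeo : Γ ≃ₜ AddCircle (1 : ℝ) :=
    Continuous.homeoOfEquivCompactToT2 (f := Equiv.ofBijective _ hbij) hg
  exact ⟨hhomeo.trans (AddCircle.homeomorphCircle one_ne_zero)⟩

end Circle

variable {E Γ : Type*} [TopologicalSpace E] [DiscreteTopology E] [Finite E]
  [TopologicalSpace Γ] {Φ : E × I → Γ} (h : IsGraphModel Φ)

include h in
/-- A reparametrization that identifies the two preimages of a point. -/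
theorem exists_descend {E' : Type*} [TopologicalSpace E'] [DiscreteTopology E'] {ρ : E × I → E' × I}
    (hρ : Continuous ρ) (hsurj : Function.Surjective ρ) {p : Γ} {a b : E × I}
    (hp : Φ ⁻¹' {p} = {a, b}) (hab : ρ a = ρ b)
    (hinj : ∀ x y, ρ x = ρ y → x = y ∨ (Φ x = p ∧ Φ y = p))
    (hint : ∀ x, 0 < (ρ x).2 → (ρ x).2 < 1 → Φ x ≠ p → 0 < x.2 ∧ x.2 < 1) :
    ∃ Φ' : E' × I → Γ, IsGraphModel Φ' ∧ ∀ q, (Φ' ⁻¹' {q}).encard ≤ (Φ ⁻¹' {q}).encard := by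
  have hΦρ : ∀ x, Φ (Function.surjInv hsurj (ρ x)) = Φ x := by
    intro x
    rcases hinj _ _ (Function.surjInv_eq hsurj (ρ x)) with h1 | h1
    · rw [h1]
    · rw [h1.1, h1.2]
  have hcomp : (fun z => Φ (Function.surjInv hsurj z)) ∘ ρ = Φ := funext hΦρ
  refine ⟨fun z => Φ (Function.surjInv hsurj z), ⟨?_, ?_, ?_⟩, fun q => ?_⟩
  · rw [(IsQuotientMap.of_surjective_continuous hsurj hρ).continuous_iff, hcomp]
    exact h.continuous
  · intro q
    obtain ⟨x, rfl⟩ := h.surjective q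
    exact ⟨ρ x, hΦρ x⟩
  · intro e c z h0 h1 hz
    obtain ⟨x, hx⟩ := hsurj (e, c)
    obtain ⟨y, rfl⟩ := hsurj z
    rw [← hx]
    rw [hΦρ, ← hx, hΦρ] at hz
    -- The merged point `p` may now be interior to an edge; it is harmless because its two former
    -- preimages have the same image under `ρ`.
    by_cases hxp : Φ x = p
    · have hfib : ∀ w, Φ w = p → ρ w = ρ a := by
        intro w hw
        have : w ∈ Φ ⁻¹' {p} := hw
        rw [hp] at this
        rcases this with rfl | rfl
        · rfl
        · exact hab.symm
      rw [hfib x hxp, hfib y (hz.trans hxp)]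
    · obtain ⟨hx0, hx1⟩ := hint x (by rw [hx]; exact h0) (by rw [hx]; exact h1) hxp
      rw [h.eq_of_interior x.1 x.2 y hx0 hx1 hz]
  · refine le_trans (Set.encard_le_encard ?_) (Set.encard_image_le ρ _)
    intro z hz
    obtain ⟨x, rfl⟩ := hsurj z
    exact ⟨x, (hΦρ x).symm.trans hz, rfl⟩

open Classical in
/-- Merging the edge of `b` into the edge of `a`, the end `b` being glued to the end `a`. -/
noncomputable def mergeMap (a b : E × I) (hne : a.1 ≠ b.1) (x : E × I) : {e : E // e ≠ b.1} × I :=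
  if hx : x.1 = b.1 then
    (⟨a.1, hne⟩, Set.projIcc 0 1 zero_le_one ((1 + |(x.2 : ℝ) - b.2|) / 2))
  else (⟨x.1, hx⟩, if x.1 = a.1 then
    Set.projIcc 0 1 zero_le_one ((1 - |(x.2 : ℝ) - a.2|) / 2) else x.2)

theorem abs_sub_le_one (c d : I) : |(c : ℝ) - d| ≤ 1 :=
  abs_le.2 ⟨by linarith [c.2.1, d.2.2], by linarith [c.2.2, d.2.1]⟩

theorem eq_of_abs_sub_eq {τ c d : I} (hτ : τ = 0 ∨ τ = 1) (hcd : |(c : ℝ) - τ| = |(d : ℝ) - τ|) :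
    c = d := by
  ext
  have := c.2.1; have := c.2.2; have := d.2.1; have := d.2.2
  rcases hτ with rfl | rfl
  · simpa [abs_of_nonneg, *] using hcd
  · simp only [Set.Icc.coe_one] at hcd
    rw [abs_of_nonpos (by linarith), abs_of_nonpos (by linarith)] at hcd
    linarith

theorem exists_abs_sub_eq {τ : I} (hτ : τ = 0 ∨ τ = 1) {r : ℝ} (hr : r ∈ Set.Icc (0 : ℝ) 1) :
    ∃ c : I, |(c : ℝ) - τ| = r := by
  rcases hτ with rfl | rfl
  · exact ⟨⟨r, hr⟩, by simp [abs_of_nonneg hr.1]⟩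
  · exact ⟨⟨1 - r, by linarith [hr.2], by linarith [hr.1]⟩, by simp [abs_of_nonneg hr.1]⟩

section Merge

variable {a b : E × I} (hne : a.1 ≠ b.1)

theorem mergeMap_of_eq_right (c : I) :
    ∃ hy, mergeMap a b hne (b.1, c) =
      (⟨a.1, hne⟩, ⟨(1 + |(c : ℝ) - b.2|) / 2, hy⟩) := by
  have hy : (1 + |(c : ℝ) - b.2|) / 2 ∈ Set.Icc (0 : ℝ) 1 :=
    ⟨by positivity, by linarith [abs_sub_le_one c b.2]⟩
  refine ⟨hy, ?_⟩
  rw [mergeMap, dif_pos rfl, Set.projIcc_of_mem _ hy]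

theorem mergeMap_of_eq_left (c : I) :
    ∃ hy, mergeMap a b hne (a.1, c) =
      (⟨a.1, hne⟩, ⟨(1 - |(c : ℝ) - a.2|) / 2, hy⟩) := by
  have hy : (1 - |(c : ℝ) - a.2|) / 2 ∈ Set.Icc (0 : ℝ) 1 :=
    ⟨by linarith [abs_sub_le_one c a.2], by linarith [abs_nonneg ((c : ℝ) - a.2)]⟩
  refine ⟨hy, ?_⟩
  rw [mergeMap, dif_neg hne, if_pos rfl, Set.projIcc_of_mem _ hy]

theorem mergeMap_of_ne {e : E} (hb : e ≠ b.1) (ha : e ≠ a.1) (c : I) :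
    mergeMap a b hne (e, c) = (⟨e, hb⟩, c) := by
  rw [mergeMap, dif_neg hb, if_neg ha]

theorem continuous_mergeMap : Continuous (mergeMap a b hne) := by
  rw [continuous_prod_of_discrete_left]
  intro e
  unfold mergeMap
  dsimp only
  split_ifs
  · exact continuous_const.prodMk (continuous_projIcc.comp (by fun_prop))
  · exact continuous_const.prodMk (continuous_projIcc.comp (by fun_prop))
  · exact continuous_const.prodMk continuous_id

/-- The edge of `a` fills `[0, 1/2]` and the edge of `b` fills `[1/2, 1]`, with `a` and `b` both
sent to the midpoint. -/
theorem surjective_mergeMap (ha : a.2 = 0 ∨ a.2 = 1) (hb : b.2 = 0 ∨ b.2 = 1) :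
    Function.Surjective (mergeMap a b hne) := by
  rintro ⟨⟨e, he⟩, y⟩
  have hy0 := y.2.1
  have hy1 := y.2.2
  by_cases hea : e = a.1
  · subst hea
    rcases le_total (y : ℝ) (1 / 2) with hy | hy
    · obtain ⟨c, hc⟩ := exists_abs_sub_eq ha (r := 1 - 2 * y) ⟨by linarith, by linarith⟩
      obtain ⟨hm, h1⟩ := mergeMap_of_eq_left hne c
      refine ⟨_, h1.trans (Prod.ext rfl (Subtype.ext ?_))⟩
      simp only [hc]; ring
    · obtain ⟨c, hc⟩ := exists_abs_sub_eq hb (r := 2 * y - 1) ⟨by linarith, by linarith⟩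
      obtain ⟨hm, h1⟩ := mergeMap_of_eq_right hne c
      refine ⟨_, h1.trans (Prod.ext rfl (Subtype.ext ?_))⟩
      simp only [hc]; ring
  · exact ⟨(e, y), mergeMap_of_ne hne he hea y⟩

/-- The two halves of the merged edge meet only at the midpoint, which comes from `a` and `b` alone.
-/
theorem mergeMap_inj (ha : a.2 = 0 ∨ a.2 = 1) (hb : b.2 = 0 ∨ b.2 = 1) (x y : E × I)
    (hxy : mergeMap a b hne x = mergeMap a b hne y) :
    x = y ∨ ((x = a ∨ x = b) ∧ (y = a ∨ y = b)) := by
  have cross : ∀ c d : I, mergeMap a b hne (a.1, c) = mergeMap a b hne (b.1, d) →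
      (a.1, c) = a ∧ (b.1, d) = b := by
    intro c d hcd
    obtain ⟨_, h1⟩ := mergeMap_of_eq_left hne c
    obtain ⟨_, h2⟩ := mergeMap_of_eq_right hne d
    rw [h1, h2] at hcd
    have h3 := congrArg Subtype.val (Prod.mk.inj hcd).2
    simp only at h3
    have h4 := abs_nonneg ((c : ℝ) - a.2)
    have h5 := abs_nonneg ((d : ℝ) - b.2)
    have h6 : |(c : ℝ) - a.2| = 0 := by linarith
    have h7 : |(d : ℝ) - b.2| = 0 := by linarith
    exact ⟨Prod.ext rfl (Subtype.ext (sub_eq_zero.1 (abs_eq_zero.1 h6))),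
      Prod.ext rfl (Subtype.ext (sub_eq_zero.1 (abs_eq_zero.1 h7)))⟩
  obtain ⟨e, c⟩ := x
  obtain ⟨e', d⟩ := y
  have tri : ∀ e : E, e = a.1 ∨ e = b.1 ∨ e ≠ a.1 ∧ e ≠ b.1 := fun e => by tauto
  rcases tri e with hea | heb | ⟨hea, heb⟩ <;> rcases tri e' with hea' | heb' | ⟨hea', heb'⟩
  · left
    subst hea; subst hea'
    obtain ⟨_, h1⟩ := mergeMap_of_eq_left hne c
    obtain ⟨_, h2⟩ := mergeMap_of_eq_left hne d
    rw [h1, h2] at hxy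
    have h3 := congrArg Subtype.val (Prod.mk.inj hxy).2
    simp only at h3
    rw [eq_of_abs_sub_eq ha (by linarith : |(c : ℝ) - a.2| = |(d : ℝ) - a.2|)]
  · subst hea; subst heb'
    obtain ⟨h1, h2⟩ := cross _ _ hxy
    exact Or.inr ⟨Or.inl h1, Or.inr h2⟩
  · subst hea
    obtain ⟨_, h1⟩ := mergeMap_of_eq_left hne c
    rw [h1, mergeMap_of_ne hne heb' hea'] at hxy
    exact absurd (congrArg Subtype.val (Prod.mk.inj hxy).1).symm hea'
  · subst heb; subst hea'
    obtain ⟨h1, h2⟩ := cross _ _ hxy.symm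
    exact Or.inr ⟨Or.inr h2, Or.inl h1⟩
  · left
    subst heb; subst heb'
    obtain ⟨_, h1⟩ := mergeMap_of_eq_right hne c
    obtain ⟨_, h2⟩ := mergeMap_of_eq_right hne d
    rw [h1, h2] at hxy
    have h3 := congrArg Subtype.val (Prod.mk.inj hxy).2
    simp only at h3
    rw [eq_of_abs_sub_eq hb (by linarith : |(c : ℝ) - b.2| = |(d : ℝ) - b.2|)]
  · subst heb
    obtain ⟨_, h1⟩ := mergeMap_of_eq_right hne c
    rw [h1, mergeMap_of_ne hne heb' hea'] at hxy
    exact absurd (congrArg Subtype.val (Prod.mk.inj hxy).1).symm hea'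
  · subst hea'
    obtain ⟨_, h1⟩ := mergeMap_of_eq_left hne d
    rw [h1, mergeMap_of_ne hne heb hea] at hxy
    exact absurd (congrArg Subtype.val (Prod.mk.inj hxy).1) hea
  · subst heb'
    obtain ⟨_, h1⟩ := mergeMap_of_eq_right hne d
    rw [h1, mergeMap_of_ne hne heb hea] at hxy
    exact absurd (congrArg Subtype.val (Prod.mk.inj hxy).1) hea
  · left
    rw [mergeMap_of_ne hne heb hea, mergeMap_of_ne hne heb' hea'] at hxy
    obtain ⟨h1, h2⟩ := Prod.mk.inj hxy
    exact Prod.ext (congrArg Subtype.val h1) h2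

theorem mergeMap_interior (ha : a.2 = 0 ∨ a.2 = 1) (hb : b.2 = 0 ∨ b.2 = 1) (x : E × I)
    (h0 : 0 < (mergeMap a b hne x).2) (h1 : (mergeMap a b hne x).2 < 1) (hxa : x ≠ a)
    (hxb : x ≠ b) : 0 < x.2 ∧ x.2 < 1 := by
  have key : ∀ {τ c : I}, (τ = 0 ∨ τ = 1) → c ≠ τ → |(c : ℝ) - τ| ≠ 1 → 0 < c ∧ c < 1 := by
    intro τ c hτ hc h
    rw [unitInterval.pos_iff_ne_zero, unitInterval.lt_one_iff_ne_one]
    rcases hτ with rfl | rfl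
    · exact ⟨hc, by rintro rfl; norm_num at h⟩
    · exact ⟨by rintro rfl; norm_num at h, hc⟩
  obtain ⟨e, c⟩ := x
  by_cases hea : e = a.1
  · subst hea
    obtain ⟨_, hm⟩ := mergeMap_of_eq_left hne c
    rw [hm] at h0
    have h0' : 0 < (1 - |(c : ℝ) - a.2|) / 2 := h0
    exact key ha (fun hc => hxa (Prod.ext rfl hc)) (by intro h; rw [h] at h0'; norm_num at h0')
  · by_cases heb : e = b.1
    · subst heb
      obtain ⟨_, hm⟩ := mergeMap_of_eq_right hne c
      rw [hm] at h1
      have h1' : (1 + |(c : ℝ) - b.2|) / 2 < 1 := h1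
      exact key hb (fun hc => hxb (Prod.ext rfl hc)) (by intro h; rw [h] at h1'; norm_num at h1')
    · rw [mergeMap_of_ne hne heb hea] at h0 h1
      exact ⟨h0, h1⟩

end Merge

/-- Every connected graph other than the circle has a model without bivalent vertices. -/
theorem exists_reduced {Γ : Type*} [TopologicalSpace Γ] [T2Space Γ] [ConnectedSpace Γ]
    (hcircle : IsEmpty (Γ ≃ₜ Circle)) (n : ℕ) :
    ∀ (E : Type u) [TopologicalSpace E] [DiscreteTopology E] [Finite E] (Φ : E × I → Γ),
      IsGraphModel Φ → Nat.card E = n →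
      ∃ (E' : Type u) (_ : TopologicalSpace E') (_ : DiscreteTopology E') (_ : Finite E')
        (Φ' : E' × I → Γ), IsGraphModel Φ' ∧ (∀ p, (Φ' ⁻¹' {p}).encard ≠ 2) ∧
          ∀ p, (Φ' ⁻¹' {p}).encard ≤ (Φ ⁻¹' {p}).encard := by
  induction n using Nat.strong_induction_on with
  | _ n ih =>
    intro E _ _ _ Φ h hn
    by_cases hred : ∀ p, (Φ ⁻¹' {p}).encard ≠ 2
    · exact ⟨E, _, ‹_›, ‹_›, Φ, h, hred, fun p => le_rfl⟩
    push Not at hred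
    obtain ⟨p, hp⟩ := hred
    obtain ⟨a, b, hab, hfib⟩ := Set.encard_eq_two.1 hp
    have hmem : ∀ x, Φ x = p ↔ x = a ∨ x = b := fun x => by
      change x ∈ Φ ⁻¹' {p} ↔ _
      rw [hfib]; rfl
    have hap : Φ a = p := (hmem a).2 (Or.inl rfl)
    have hbp : Φ b = p := (hmem b).2 (Or.inr rfl)
    have ha := h.endpoint_of_ne (hap.trans hbp.symm) hab
    have hb := h.endpoint_of_ne (hbp.trans hap.symm) hab.symm
    -- Both ends at `p` on one edge means that this edge is a loop attached to nothing else, so the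
    -- graph is a circle.
    by_cases hne : a.1 = b.1
    · exfalso
      have hloop : Φ (a.1, 0) = p ∧ Φ (a.1, 1) = p := by
        have ha' : a = (a.1, a.2) := rfl
        have hb' : b = (a.1, b.2) := by rw [hne]
        rcases ha with h1 | h1 <;> rcases hb with h2 | h2 <;> rw [h1] at ha' <;> rw [h2] at hb'
        · exact absurd (ha'.trans hb'.symm) hab
        · exact ⟨ha' ▸ hap, hb' ▸ hbp⟩
        · exact ⟨hb' ▸ hbp, ha' ▸ hap⟩
        · exact absurd (ha'.trans hb'.symm) hab
      obtain ⟨φ⟩ := h.nonempty_homeomorph_circle (hloop.1.trans hloop.2.symm) fun x hx => by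
        rcases (hmem x).1 (hx.trans hloop.1) with rfl | rfl
        · rfl
        · exact hne.symm
      exact hcircle.false φ
    -- Merging the two edges at `p` removes one edge, and no fibre grows.
    · obtain ⟨Φ₁, h₁, hle₁⟩ := h.exists_descend (continuous_mergeMap hne)
        (surjective_mergeMap hne ha hb) hfib (by
          obtain ⟨_, h1⟩ := mergeMap_of_eq_left (a := a) (b := b) hne a.2
          obtain ⟨_, h2⟩ := mergeMap_of_eq_right (a := a) (b := b) hne b.2
          refine h1.trans (Eq.trans ?_ h2.symm)
          simp)
        (fun x y hxy => by rw [hmem, hmem]; exact mergeMap_inj hne ha hb x y hxy)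
        (fun x h0 h1 hx => by
          rw [Ne, hmem, not_or] at hx
          exact mergeMap_interior hne ha hb x h0 h1 hx.1 hx.2)
      have hcard : Nat.card {e : E // e ≠ b.1} < n := by
        rw [← hn, ← Nat.card_congr (Equiv.subtypeUnivEquiv (fun _ : E => trivial) :
          {_e : E // True} ≃ E)]
        exact card_subtype_lt_card_subtype (fun _ _ => trivial) (a := b.1) trivial fun h => h rfl
      obtain ⟨E', i1, i2, i3, Φ', h', hred, hle⟩ := ih _ hcard {e : E // e ≠ b.1} Φ₁ h₁ rfl
      exact ⟨E', i1, i2, i3, Φ', h', hred, fun q => (hle q).trans (hle₁ q)⟩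

end IsGraphModel

/-! ### The degree as a number of edge ends. -/

namespace IsGraphModel

variable {E Γ : Type*} [TopologicalSpace E] [DiscreteTopology E] [Finite E]
  [TopologicalSpace Γ] {Φ : E × I → Γ} (h : IsGraphModel Φ)

include h

theorem exists_leg_of_starDist_lt {v p : Γ} (hp : h.starDist v p < 1) :
    ∃ a : E × I, Φ a = v ∧ (a.2 = 0 ∨ a.2 = 1) ∧ ∃ c ∈ Set.Ico (0 : ℝ) (1 / 4),
      p = legPoint Φ a c := by
  obtain ⟨e, c, τ, h1, h2, h3, h4, -⟩ := h.exists_coord_of_starDist_lt hp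
  rw [h4] at hp
  refine ⟨(e, τ), h3, h2, |(c : ℝ) - τ|, ⟨abs_nonneg _, by linarith⟩, ?_⟩
  have : (1 - |(c : ℝ) - τ|) * (τ : ℝ) + |(c : ℝ) - τ| * (1 - τ) = c := by
    rcases h2 with rfl | rfl
    · simp [abs_of_nonneg c.2.1]
    · simp only [Set.Icc.coe_one]
      rw [abs_of_nonpos (by linarith [c.2.2])]; ring
  rw [legPoint, this, edge_coe, h1]

/-- A connected neighbourhood of a vertex meets each leg in an initial interval. -/
theorem isPreconnected_inter_leg [T2Space Γ] {v : Γ} {a : E × I} (hav : Φ a = v)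
    (ha : a.2 = 0 ∨ a.2 = 1) {U : Set Γ} (hUN : U ⊆ {p | h.starDist v p < 1})
    (hUc : IsPreconnected U) (hvU : v ∈ U) :
    IsPreconnected (legPoint Φ a '' {c | c ∈ Set.Ioo (0 : ℝ) (1 / 4) ∧ legPoint Φ a c ∈ U}) := by
  have hleg := h.continuous_legPoint a
  refine IsPreconnected.image (Set.OrdConnected.isPreconnected ⟨?_⟩) _ hleg.continuousOn
  rintro c ⟨hc, -⟩ c' ⟨hc', hc'U⟩ d ⟨hcd, hdc'⟩
  have hd : d ∈ Set.Ioo (0 : ℝ) (1 / 4) := ⟨hc.1.trans_le hcd, hdc'.trans_lt hc'.2⟩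
  refine ⟨hd, ?_⟩
  by_contra hdU
  have hlt : d < c' := lt_of_le_of_ne hdc' (by rintro rfl; exact hdU hc'U)
  -- If `U` skipped the parameter `d`, the part of the leg beyond `d` would be split off from `v`.
  -- The outer end of the leg is not in `U`, being outside the star.
  have hW : IsOpen (legPoint Φ a '' Set.Ioo d (1 / 4)) :=
    h.isOpen_legPoint_image ha isOpen_Ioo (Set.Ioo_subset_Ioo_left hd.1.le)
  have hV : IsOpen (legPoint Φ a '' Set.Icc d (1 / 4))ᶜ :=
    (isCompact_Icc.image hleg).isClosed.isOpen_compl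
  have hend : legPoint Φ a (1 / 4) ∉ U := by
    intro hU
    obtain ⟨b, -, hb, x, hx, heq⟩ := h.exists_leg_of_starDist_lt (hUN hU)
    have := (h.legPoint_injective ha hb ⟨by norm_num, le_rfl⟩ ⟨hx.1, hx.2.le⟩ heq).2
    exact hx.2.ne this.symm
  have hcov : U ⊆ legPoint Φ a '' Set.Ioo d (1 / 4) ∪ (legPoint Φ a '' Set.Icc d (1 / 4))ᶜ := by
    intro p hp
    by_cases hp' : p ∈ legPoint Φ a '' Set.Icc d (1 / 4)
    · left
      obtain ⟨x, hx, rfl⟩ := hp'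
      exact ⟨x, ⟨lt_of_le_of_ne hx.1 (by rintro rfl; exact hdU hp),
        lt_of_le_of_ne hx.2 (by rintro rfl; exact hend hp)⟩, rfl⟩
    · exact Or.inr hp'
  have hvV : v ∉ legPoint Φ a '' Set.Icc d (1 / 4) := by
    rintro ⟨x, hx, hxv⟩
    have := (h.legPoint_injective ha ha ⟨hd.1.trans_le hx.1, hx.2⟩ ⟨le_rfl, by norm_num⟩
      (hxv.trans (hav.symm.trans (legPoint_zero Φ a).symm))).2
    linarith [hx.1, hd.1]
  obtain ⟨p, -, hpW, hpV⟩ := hUc _ _ hW hV hcov ⟨_, hc'U, c', ⟨hlt, hc'.2⟩, rfl⟩ ⟨v, hvU, hvV⟩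
  exact hpV (Set.image_mono Set.Ioo_subset_Icc_self hpW)

theorem endpoint_of_fiber {v : Γ} (hv : 2 ≤ (Φ ⁻¹' {v}).encard) {a : E × I} (ha : Φ a = v) :
    a.2 = 0 ∨ a.2 = 1 := by
  have hv' : 1 < (Φ ⁻¹' {v}).encard := lt_of_lt_of_le (by norm_num) hv
  obtain ⟨b, hb, hne⟩ := (Set.one_lt_encard_iff_nontrivial.1 hv').exists_ne a
  exact h.endpoint_of_ne (ha.trans (show Φ b = v from hb).symm) hne.symm

theorem notMem_regularSet {v : Γ} (hv : 2 ≤ (Φ ⁻¹' {v}).encard) : v ∉ regularSet Φ := by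
  have hv' : 1 < (Φ ⁻¹' {v}).encard := lt_of_lt_of_le (by norm_num) hv
  obtain ⟨a, ha, b, hb, hne⟩ := Set.one_lt_encard_iff_nontrivial.1 hv'
  exact fun hreg => hne (hreg a b ha hb)

/-- The degree of a vertex is the number of edge ends at it. -/
theorem encard_connectedComponents [T2Space Γ] {v : Γ} (hv : 2 ≤ (Φ ⁻¹' {v}).encard) {U : Set Γ}
    (hUN : U ⊆ {p | h.starDist v p < 1}) (hU : IsOpen U) (hvU : v ∈ U) (hUc : IsConnected U) :
    ENat.card (ConnectedComponents (U \ {v} : Set Γ)) = (Φ ⁻¹' {v}).encard := by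
  have hend : ∀ a : (Φ ⁻¹' {v} : Set (E × I)), a.1.2 = 0 ∨ a.1.2 = 1 := fun a =>
    h.endpoint_of_fiber hv a.2
  have hne : ∀ (a : (Φ ⁻¹' {v} : Set (E × I))) (c : ℝ), c ∈ Set.Ioo (0 : ℝ) (1 / 4) →
      legPoint Φ a.1 c ≠ v := by
    intro a c hc heq
    have := (h.legPoint_injective (hend a) (hend a) ⟨hc.1, hc.2.le⟩ ⟨le_rfl, by norm_num⟩
      (heq.trans ((show Φ a.1 = v from a.2).symm.trans (legPoint_zero Φ a.1).symm))).2
    exact hc.1.ne' this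
  have hpt : ∀ a : (Φ ⁻¹' {v} : Set (E × I)), ∃ c ∈ Set.Ioo (0 : ℝ) (1 / 4),
      legPoint Φ a.1 c ∈ U := by
    intro a
    have hopen : IsOpen (legPoint Φ a.1 ⁻¹' U) := hU.preimage (h.continuous_legPoint _)
    have h0 : (0 : ℝ) ∈ legPoint Φ a.1 ⁻¹' U := by
      change legPoint Φ a.1 0 ∈ U
      rw [legPoint_zero, show Φ a.1 = v from a.2]; exact hvU
    obtain ⟨ε, hε, hball⟩ := Metric.isOpen_iff.1 hopen 0 h0
    have hm : 0 < min (ε / 2) (1 / 8) := by positivity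
    refine ⟨min (ε / 2) (1 / 8), ⟨hm, by linarith [min_le_right (ε / 2) (1 / 8)]⟩, hball ?_⟩
    rw [Metric.mem_ball, Real.dist_eq, sub_zero, abs_of_pos hm]
    linarith [min_le_left (ε / 2) (1 / 8)]
  choose c hc hcU using hpt
  let P : (Φ ⁻¹' {v} : Set (E × I)) → (U \ {v} : Set Γ) := fun a =>
    ⟨legPoint Φ a.1 (c a), hcU a, hne a _ (hc a)⟩
  -- The open legs cut the punctured neighbourhood into disjoint nonempty clopen connected pieces,
  -- which are therefore its components.
  let L : (Φ ⁻¹' {v} : Set (E × I)) → Set (U \ {v} : Set Γ) := fun a => {p | p.1 ∈ openLeg Φ a.1}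
  have hLopen : ∀ a, IsOpen (L a) := fun a =>
    (h.isOpen_legPoint_image (hend a) isOpen_Ioo subset_rfl).preimage continuous_subtype_val
  have hLcov : ∀ p : (U \ {v} : Set Γ), ∃ a, p ∈ L a := by
    rintro ⟨p, hpU, hpv⟩
    obtain ⟨a, hav, ha, x, hx, rfl⟩ := h.exists_leg_of_starDist_lt (hUN hpU)
    refine ⟨⟨a, hav⟩, x, ⟨lt_of_le_of_ne hx.1 ?_, hx.2⟩, rfl⟩
    rintro rfl
    rw [legPoint_zero] at hpv
    exact hpv hav
  have hLdisj : ∀ a b p, p ∈ L a → p ∈ L b → a = b := by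
    rintro a b p ⟨x, hx, hxp⟩ ⟨y, hy, hyp⟩
    exact Subtype.ext (h.legPoint_injective (hend a) (hend b) ⟨hx.1, hx.2.le⟩ ⟨hy.1.le, hy.2.le⟩
      (hxp.trans hyp.symm)).1
  have hLclopen : ∀ a, IsClopen (L a) := by
    refine fun a => ⟨?_, hLopen a⟩
    have : L a = (⋃ b, ⋃ (_ : b ≠ a), L b)ᶜ := by
      ext p
      simp only [Set.mem_compl_iff, Set.mem_iUnion, not_exists]
      constructor
      · intro hp b hb hpb
        exact hb (hLdisj b a p hpb hp)
      · intro hp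
        obtain ⟨b, hb⟩ := hLcov p
        by_cases hba : b = a
        · rwa [← hba]
        · exact absurd hb (hp b hba)
    rw [this]
    exact (isOpen_iUnion fun b => isOpen_iUnion fun _ => hLopen b).isClosed_compl
  have hPL : ∀ a, P a ∈ L a := fun a => ⟨c a, hc a, rfl⟩
  have hLconn : ∀ a, IsPreconnected (L a) := by
    intro a
    rw [← IsInducing.subtypeVal.isPreconnected_image]
    convert h.isPreconnected_inter_leg a.2 (hend a) hUN hUc.isPreconnected hvU using 1
    ext p
    constructor
    · rintro ⟨⟨_, hpU, hpv⟩, ⟨x, hx, rfl⟩, rfl⟩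
      exact ⟨x, ⟨hx, hpU⟩, rfl⟩
    · rintro ⟨x, ⟨hx, hxU⟩, rfl⟩
      exact ⟨⟨_, hxU, hne a x hx⟩, ⟨x, hx, rfl⟩, rfl⟩
  have hbij : Function.Bijective fun a => (P a : ConnectedComponents (U \ {v} : Set Γ)) := by
    constructor
    · intro a b hab
      have h1 := ConnectedComponents.coe_eq_coe'.1 hab
      exact hLdisj a b (P a) (hPL a) ((hLclopen b).connectedComponent_subset (hPL b) h1)
    · intro q
      obtain ⟨p, rfl⟩ := ConnectedComponents.surjective_coe q
      obtain ⟨a, ha⟩ := hLcov p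
      exact ⟨a, ConnectedComponents.coe_eq_coe'.2
        ((hLconn a).subset_connectedComponent ha (hPL a))⟩
  exact (ENat.card_congr (Equiv.ofBijective _ hbij)).symm

theorem hasDegree [T2Space Γ] {v : Γ} (hv : 2 ≤ (Φ ⁻¹' {v}).encard) :
    HasDegree v (Φ ⁻¹' {v}).ncard := by
  have hfin : (Φ ⁻¹' {v}).Finite :=
    ((Set.finite_univ (α := E)).prod (Set.toFinite {(0 : I), 1})).subset
      fun a ha => ⟨Set.mem_univ _, h.endpoint_of_fiber hv ha⟩
  refine ⟨{p | h.starDist v p < 1}, ?_, fun U hUN hU hvU hUc => ?_⟩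
  · refine (isOpen_lt (h.continuous_starDist v) continuous_const).mem_nhds ?_
    change h.starDist v v < 1
    rw [h.starDist_self (h.notMem_regularSet hv)]
    exact one_pos
  · rw [h.encard_connectedComponents hv hUN hU hvU hUc, hfin.cast_ncard_eq]

end IsGraphModel

/-! ### The arc model given by a CW structure. -/

section CW

variable {Γ : Type u} [TopologicalSpace Γ] [CWComplex (Set.univ : Set Γ)]

open RelCWComplex

theorem openCell_zero_eq (i : cell (Set.univ : Set Γ) 0) :
    openCell 0 i = {vertexPoint Γ i} := by
  rw [openCell_zero_eq_singleton, vertexPoint]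
  congr 2
  exact Subsingleton.elim _ _

theorem closedCell_zero_eq (i : cell (Set.univ : Set Γ) 0) :
    closedCell 0 i = {vertexPoint Γ i} := by
  rw [closedCell_zero_eq_singleton, vertexPoint]
  congr 2
  exact Subsingleton.elim _ _

theorem IsGraph.mem_cell (hΓ : IsGraph Γ) (p : Γ) :
    p ∈ Set.range (vertexPoint Γ) ∨ ∃ e : cell (Set.univ : Set Γ) 1, p ∈ openCell 1 e := by
  have hp : p ∈ ⋃ (n : ℕ) (j : cell (Set.univ : Set Γ) n), openCell n j := by
    rw [CWComplex.iUnion_openCell_eq_complex]; trivial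
  simp only [Set.mem_iUnion] at hp
  obtain ⟨n, j, hj⟩ := hp
  rcases n with - | - | n
  · rw [openCell_zero_eq] at hj
    exact Or.inl ⟨j, hj.symm⟩
  · exact Or.inr ⟨j, hj⟩
  · exact ((hΓ.dim_le_one _ (by omega)).false j).elim

theorem IsGraph.finite_range_vertexPoint (hΓ : IsGraph Γ) : (Set.range (vertexPoint Γ)).Finite := by
  have := hΓ.finite
  have : Finite (cell (Set.univ : Set Γ) 0) := FiniteType.finite_cell 0
  exact Set.finite_range _

theorem IsGraph.subsingleton (hΓ : IsGraph Γ) [ConnectedSpace Γ]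
    (hE : IsEmpty (cell (Set.univ : Set Γ) 1)) : Subsingleton Γ := by
  have := hΓ.hausdorff
  have hfin : (Set.univ : Set Γ).Finite := hΓ.finite_range_vertexPoint.subset fun p _ => by
    rcases hΓ.mem_cell p with hp | ⟨e, -⟩
    · exact hp
    · exact (hE.false e).elim
  have := Set.finite_univ_iff.1 hfin
  exact subsingleton_of_forall_eq (Classical.arbitrary Γ) fun p => by
    by_contra hne
    have hcl : IsClopen ({p} : Set Γ) := isClopen_discrete _
    have := hcl.eq_univ ⟨p, rfl⟩
    have hm : Classical.arbitrary Γ ∈ ({p} : Set Γ) := by rw [this]; trivial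
    exact hne hm.symm

/-- The parametrization of a graph by its one-dimensional cells. -/
noncomputable def cellMap (Γ : Type u) [TopologicalSpace Γ] [CWComplex (Set.univ : Set Γ)]
    (a : cell (Set.univ : Set Γ) 1 × I) : Γ :=
  map (C := (Set.univ : Set Γ)) 1 a.1 fun _ => 2 * (a.2 : ℝ) - 1

theorem cellMap_mem_openCell {e : cell (Set.univ : Set Γ) 1} {c : I} (h0 : 0 < c) (h1 : c < 1) :
    cellMap Γ (e, c) ∈ openCell 1 e := by
  refine ⟨_, ?_, rfl⟩
  have h0' : (0 : ℝ) < c := h0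
  have h1' : (c : ℝ) < 1 := h1
  rw [mem_ball_zero_iff, pi_norm_const, Real.norm_eq_abs, abs_lt]
  constructor <;> simp only <;> linarith

theorem cellMap_endpoint {a : cell (Set.univ : Set Γ) 1 × I} (ha : a.2 = 0 ∨ a.2 = 1) :
    cellMap Γ a ∈ Set.range (vertexPoint Γ) := by
  have hmem : cellMap Γ a ∈ cellFrontier 1 a.1 := by
    refine ⟨_, ?_, rfl⟩
    rw [mem_sphere_zero_iff_norm, pi_norm_const, Real.norm_eq_abs]
    rcases ha with ha | ha <;> rw [ha] <;> norm_num
  obtain ⟨x, y, hxy⟩ := CWComplex.exists_cellFrontier_one_eq a.1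
  rw [hxy, closedCell_zero_eq, closedCell_zero_eq] at hmem
  rcases hmem with hm | hm
  · exact ⟨x, hm.symm⟩
  · exact ⟨y, hm.symm⟩

theorem openCell_subset_range_cellMap (e : cell (Set.univ : Set Γ) 1) :
    openCell 1 e ⊆ Set.range (cellMap Γ) := by
  rintro _ ⟨x, hx, rfl⟩
  rw [mem_ball_zero_iff] at hx
  have hx0 := abs_lt.1 ((norm_le_pi_norm x 0).trans_lt hx)
  refine ⟨(e, ⟨(x 0 + 1) / 2, by linarith [hx0.1], by linarith [hx0.2]⟩), ?_⟩
  simp only [cellMap]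
  congr 1
  funext j
  rw [Subsingleton.elim j 0]
  ring

theorem isGraphModel_cellMap (hΓ : IsGraph Γ) [ConnectedSpace Γ]
    [TopologicalSpace (cell (Set.univ : Set Γ) 1)] [DiscreteTopology (cell (Set.univ : Set Γ) 1)]
    [Nonempty (cell (Set.univ : Set Γ) 1)] : IsGraphModel (cellMap Γ) := by
  have := hΓ.hausdorff
  have := hΓ.finite
  have : Finite (cell (Set.univ : Set Γ) 1) := FiniteType.finite_cell 1
  have hcont : Continuous (cellMap Γ) := by
    rw [continuous_prod_of_discrete_left]
    intro e
    refine (RelCWComplex.continuousOn 1 e).comp_continuous (by fun_prop) fun c => ?_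
    rw [mem_closedBall_zero_iff, pi_norm_const, Real.norm_eq_abs, abs_le]
    constructor <;> simp only <;> linarith [c.2.1, c.2.2]
  refine ⟨hcont, ?_, fun e c a h0 h1 ha => ?_⟩
  -- The image of the edges is compact and misses at most finitely many vertices, so it is clopen;
  -- connectedness excludes isolated vertices.
  · have hcl : IsClosed (Set.range (cellMap Γ)) := (isCompact_range hcont).isClosed
    have hcl' : IsClosed (Set.range (cellMap Γ))ᶜ := by
      refine (hΓ.finite_range_vertexPoint.subset fun p hp => ?_).isClosed
      rcases hΓ.mem_cell p with h1 | ⟨e, he⟩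
      · exact h1
      · exact absurd (openCell_subset_range_cellMap e he) hp
    exact Set.range_eq_univ.1
      (IsClopen.eq_univ ⟨hcl, isClosed_compl_iff.1 hcl'⟩ (Set.range_nonempty _))
  · have hmem := cellMap_mem_openCell (Γ := Γ) (e := e) h0 h1
    by_cases hend : a.2 = 0 ∨ a.2 = 1
    · exfalso
      obtain ⟨i, hi⟩ := cellMap_endpoint (Γ := Γ) hend
      have := eq_of_not_disjoint_openCell (C := (Set.univ : Set Γ)) (j := i) (i := e)
        (Set.not_disjoint_iff.2 ⟨_, by rw [openCell_zero_eq, hi, ha]; rfl, hmem⟩)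
      exact absurd (congrArg Sigma.fst this) (by norm_num)
    · rw [not_or] at hend
      obtain ⟨e', c'⟩ := a
      have h0' := unitInterval.pos_iff_ne_zero.2 hend.1
      have h1' := unitInterval.lt_one_iff_ne_one.2 hend.2
      have hmem' := cellMap_mem_openCell (Γ := Γ) (e := e') h0' h1'
      rw [ha] at hmem'
      have heq := eq_of_not_disjoint_openCell (C := (Set.univ : Set Γ)) (j := e') (i := e)
        (Set.not_disjoint_iff.2 ⟨_, hmem', hmem⟩)
      obtain rfl : e' = e := by simpa using heq
      have hball : ∀ d : I, 0 < d → d < 1 →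
          (fun _ => 2 * (d : ℝ) - 1 : Fin 1 → ℝ) ∈ (map (C := (Set.univ : Set Γ)) 1 e').source := by
        intro d h0 h1
        have h0' : (0 : ℝ) < d := h0
        have h1' : (d : ℝ) < 1 := h1
        rw [source_eq, mem_ball_zero_iff, pi_norm_const, Real.norm_eq_abs, abs_lt]
        constructor <;> linarith
      have := (map (C := (Set.univ : Set Γ)) 1 e').injOn (hball c' h0' h1') (hball c h0 h1) ha
      have h2 := congrFun this 0
      exact Prod.ext rfl (Subtype.ext (by linarith : (c' : ℝ) = c))

end CW

/-! ### Trivial cases and assembly of the theorem. -/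

theorem TC_conf_eq_zero_of_subsingleton {k r : ℕ} (hr : 0 < r) {X : Type*} [TopologicalSpace X]
    [Subsingleton (OrderedConf k X)] :
    TC r (OrderedConf k X) = 0 ∧ TC r (UnorderedConf k X) = 0 := by
  have : Subsingleton (UnorderedConf k X) := toUnordered_surjective.subsingleton
  exact ⟨TC_eq_zero_of_subsingleton r hr, TC_eq_zero_of_subsingleton r hr⟩

theorem joined_orderedConf_one {X : Type*} [TopologicalSpace X] [PathConnectedSpace X]
    (x y : OrderedConf 1 X) : Joined x y := by
  refine joined_of_joinedIn 0 (fun j hj => absurd (Subsingleton.elim j 0) hj) ?_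
  have : {p | ∀ j ≠ (0 : Fin 1), p ≠ x.1 j} = Set.univ :=
    Set.eq_univ_of_forall fun p j hj => absurd (Subsingleton.elim j 0) hj
  rw [this, joinedIn_univ]
  exact PathConnectedSpace.joined _ _

/-- A graph without bivalent vertices has at most as many branch points as any CW structure has
essential vertices. -/
theorem ncard_compl_regularSet_le {Γ : Type*} [TopologicalSpace Γ]
    [CWComplex (Set.univ : Set Γ)] (hΓ : IsGraph Γ) [ConnectedSpace Γ]
    [TopologicalSpace (RelCWComplex.cell (Set.univ : Set Γ) 1)]
    [DiscreteTopology (RelCWComplex.cell (Set.univ : Set Γ) 1)]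
    [Nonempty (RelCWComplex.cell (Set.univ : Set Γ) 1)] {E : Type*} {Φ : E × I → Γ}
    (hle : ∀ v ∈ (regularSet Φ)ᶜ, 3 ≤ (cellMap Γ ⁻¹' {v}).encard) :
    (regularSet Φ)ᶜ.ncard ≤ essentialCount Γ := by
  have := hΓ.hausdorff
  have := hΓ.finite
  have : Finite (RelCWComplex.cell (Set.univ : Set Γ) 1) :=
    RelCWComplex.FiniteType.finite_cell 1
  have : Finite (RelCWComplex.cell (Set.univ : Set Γ) 0) :=
    RelCWComplex.FiniteType.finite_cell 0
  have h := isGraphModel_cellMap hΓ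
  have hsub : (regularSet Φ)ᶜ ⊆ vertexPoint Γ '' {i | IsEssential Γ i} := by
    intro v hv
    have h3 := hle v hv
    have h2 : 2 ≤ (cellMap Γ ⁻¹' {v}).encard := le_trans (by norm_num) h3
    obtain ⟨a, ha⟩ : (cellMap Γ ⁻¹' {v}).Nonempty := by
      rw [← Set.encard_pos]; exact lt_of_lt_of_le (by norm_num) h3
    obtain ⟨i, hi⟩ := cellMap_endpoint (Γ := Γ) (h.endpoint_of_fiber h2 ha)
    have hi' : vertexPoint Γ i = v := hi.trans ha
    subst hi'
    refine ⟨i, ⟨_, ?_, h.hasDegree h2⟩, rfl⟩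
    have hfin : (cellMap Γ ⁻¹' {vertexPoint Γ i}).Finite :=
      ((Set.finite_univ.prod (Set.toFinite {(0 : I), 1}))).subset
        fun a ha => ⟨Set.mem_univ _, h.endpoint_of_fiber h2 ha⟩
    rw [← hfin.cast_ncard_eq] at h3
    exact_mod_cast h3
  calc (regularSet Φ)ᶜ.ncard ≤ (vertexPoint Γ '' {i | IsEssential Γ i}).ncard :=
        Set.ncard_le_ncard hsub (Set.toFinite _)
    _ ≤ {i | IsEssential Γ i}.ncard := Set.ncard_image_le (Set.toFinite _)

theorem TC_conf_le {Γ : Type*} [TopologicalSpace Γ] [CWComplex (Set.univ : Set Γ)]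
    (hΓ : IsGraph Γ) [ConnectedSpace Γ] (k r : ℕ) (hr : 0 < r)
    (hcircle : 1 ≤ k → IsEmpty (Γ ≃ₜ Circle)) :
    ((2 ≤ k → IsEmpty (Γ ≃ₜ unitInterval)) →
      TC r (OrderedConf k Γ) ≤ ((r * essentialCount Γ : ℕ) : ℕ∞)) ∧
    TC r (UnorderedConf k Γ) ≤ ((r * essentialCount Γ : ℕ) : ℕ∞) := by
  have htriv : Subsingleton (OrderedConf k Γ) →
      ((2 ≤ k → IsEmpty (Γ ≃ₜ unitInterval)) →
        TC r (OrderedConf k Γ) ≤ ((r * essentialCount Γ : ℕ) : ℕ∞)) ∧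
      TC r (UnorderedConf k Γ) ≤ ((r * essentialCount Γ : ℕ) : ℕ∞) := by
    intro _
    obtain ⟨h1, h2⟩ := TC_conf_eq_zero_of_subsingleton (k := k) hr (X := Γ)
    rw [h1, h2]
    exact ⟨fun _ => zero_le, zero_le⟩
  rcases Nat.eq_zero_or_pos k with rfl | hk
  · exact htriv ⟨fun x y => Subtype.ext (Subsingleton.elim _ _)⟩
  rcases isEmpty_or_nonempty (RelCWComplex.cell (Set.univ : Set Γ) 1) with hE | hE
  · have := hΓ.subsingleton hE
    exact htriv ⟨fun x y => Subtype.ext (Subsingleton.elim _ _)⟩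
  have := hΓ.hausdorff
  have := hΓ.finite
  have : Finite (RelCWComplex.cell (Set.univ : Set Γ) 1) :=
    RelCWComplex.FiniteType.finite_cell 1
  let : TopologicalSpace (RelCWComplex.cell (Set.univ : Set Γ) 1) := ⊥
  have : DiscreteTopology (RelCWComplex.cell (Set.univ : Set Γ) 1) := ⟨rfl⟩
  obtain ⟨E, _, _, _, Φ, h, hred, hle⟩ :=
    IsGraphModel.exists_reduced (hcircle hk) _ _ _ (isGraphModel_cellMap hΓ) rfl
  -- A non-regular point has at least two preimages, and the reduced model excludes exactly two.
  have hthree : ∀ v ∈ (regularSet Φ)ᶜ, 3 ≤ (Φ ⁻¹' {v}).encard := by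
    intro v hv
    have h2 : 1 < (Φ ⁻¹' {v}).encard := by
      rw [Set.one_lt_encard_iff_nontrivial]
      simp only [regularSet, Set.mem_compl_iff, Set.mem_ofPred_eq, not_forall] at hv
      obtain ⟨a, b, ha, hb, hne⟩ := hv
      exact ⟨a, ha, b, hb, hne⟩
    have h2' : 2 ≤ (Φ ⁻¹' {v}).encard := by
      have := Order.add_one_le_of_lt h2
      rwa [one_add_one_eq_two] at this
    have h3 := Order.add_one_le_of_lt (lt_of_le_of_ne h2' (hred v).symm)
    rwa [two_add_one_eq_three] at h3
  have hcount : (((r * (regularSet Φ)ᶜ.ncard : ℕ)) : ℕ∞) ≤ ((r * essentialCount Γ : ℕ) : ℕ∞) := by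
    have := ncard_compl_regularSet_le hΓ (Φ := Φ) fun v hv => (hthree v hv).trans (hle v)
    exact_mod_cast Nat.mul_le_mul_left r this
  have := h.pathConnectedSpace
  obtain ⟨⟨e, -⟩⟩ := h.nonempty_of_point (Classical.arbitrary Γ)
  have : Nonempty E := ⟨e⟩
  have hne := h.nonempty_orderedConf k
  have hord : ∀ hJ : ∀ x y : OrderedConf k Γ, Joined x y,
      TC r (OrderedConf k Γ) ≤ ((r * essentialCount Γ : ℕ) : ℕ∞) ∧
        TC r (UnorderedConf k Γ) ≤ ((r * essentialCount Γ : ℕ) : ℕ∞) := by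
    intro hJ
    have : PathConnectedSpace (OrderedConf k Γ) := ⟨hne, hJ⟩
    have : PathConnectedSpace (UnorderedConf k Γ) :=
      toUnordered_surjective.pathConnectedSpace continuous_toUnordered
    exact ⟨(h.TC_orderedConf_le hr).trans hcount, (h.TC_unorderedConf_le hr).trans hcount⟩
  -- Without branch points the graph is an interval, so the hypothesis on ordered configurations
  -- leaves only one particle. A branch point makes even the ordered space path-connected.
  by_cases hreg : regularSet Φ = Set.univ
  · constructor
    · intro hint
      obtain rfl : k = 1 := by
        by_contra hk1
        obtain ⟨φ⟩ := h.nonempty_homeomorph_unitInterval hreg e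
        exact (hint (by omega)).false φ
      exact (hord joined_orderedConf_one).1
    · have : PathConnectedSpace (UnorderedConf k Γ) := by
        refine ⟨hne.map toUnordered, fun a b => ?_⟩
        obtain ⟨x, rfl⟩ := toUnordered_surjective a
        obtain ⟨y, rfl⟩ := toUnordered_surjective b
        exact h.joined_toUnordered_of_regular hreg e x y
      exact (h.TC_unorderedConf_le hr).trans hcount
  · obtain ⟨v, hv⟩ := (Set.ne_univ_iff_exists_notMem _).1 hreg
    have := hord fun x y => h.joined_orderedConf (hthree v hv) x y
    exact ⟨fun _ => this.1, this.2⟩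

end GraphConfig

theorem corollary3p12 {Γ : Type*} [TopologicalSpace Γ] [Topology.CWComplex (Set.univ : Set Γ)]
    (hΓ : GraphConfig.IsGraph Γ) (hconn : ConnectedSpace Γ) (k r : ℕ) (hr : 0 < r)
    (hcircle : 1 ≤ k → IsEmpty (Γ ≃ₜ Circle)) :
    ((2 ≤ k → IsEmpty (Γ ≃ₜ unitInterval)) →
      GraphConfig.TC r (GraphConfig.OrderedConf k Γ) ≤
        ((r * GraphConfig.essentialCount Γ : ℕ) : ℕ∞)) ∧
    GraphConfig.TC r (GraphConfig.UnorderedConf k Γ) ≤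
      ((r * GraphConfig.essentialCount Γ : ℕ) : ℕ∞) :=
  GraphConfig.TC_conf_le hΓ k r hr hcircle
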